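/- **Setting.** Fix a finite field $\mathbb F$, a subset $H\subseteq\mathbb F$, integers $m,d,D\ge 1$ with $D\le|\mathbb F|$, and put $\mu=2^m$. Let $\mathcal P$ be the space of $\mu$-variate polynomials over $\mathbb F$ with partial degrees $\le d$ and total degree $\le D$. A polynomial in fewer variables is regarded as a polynomial in the first of the $\mu$ variables, and a value at a shorter point is a value at that point padded with zeros. $\lambda$ is the security parameter, PPT means probabilistic polynomial time in $\lambda$, and a function $\varepsilon:\mathbb N\to\mathbb R$ is negligible if for every integer $c>0$ one has $|\varepsilon(\lambda)|<\lambda^{-c}$ for all large $\lambda$. **Commitment scheme.** A PCS for $\mathcal P$ with batched evaluation consists of a randomised $\mathsf{Setup}(1^\lambda)$ producing public parameters $\mathsf{pp}$; a deterministic $\mathsf{Commit}(\mathsf{pp},f)$; an algorithm $\mathsf{Open}(\mathsf{pp},f,C)$ that accepts iff $C=\mathsf{Commit}(\mathsf{pp},f)$; and, for every $\ell$, an interactive protocol $\ell\text{-}\mathsf{Eval}$ with polynomially many rounds for claims about the values $y_1,\dots,y_\ell$ of the polynomials committed to in $C_1,\dots,C_\ell$ at a common point $x\in\mathbb F^\mu$,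 where the variables of each polynomial may be shifted (each variable is read at a prescribed coordinate of $x$, or set to $0$); it has a PPT honest prover which, given polynomials $f_i$ with $C_i=\mathsf{Commit}(\mathsf{pp},f_i)$, always convinces the verifier of the true values. The scheme is * *extractable* if for every PPT $A$ there is a PPT $E$ such that, for $\mathsf{pp}\leftarrow\mathsf{Setup}(1^\lambda)$, $C\leftarrow A(\mathsf{pp})$, $f\leftarrow E(C,\mathsf{pp})$, the probability that $C=\mathsf{Commit}(\mathsf{pp},g)$ for some $g\in\mathcal P$ but $\mathsf{Open}(\mathsf{pp},f,C)$ rejects is negligible; * *computationally binding* if for every PPT $A$ the probability that $A(\mathsf{pp})$ outputs $f\ne g$ and $C$ such that $\mathsf{Open}(\mathsf{pp},f,C)$ and $\mathsf{Open}(\mathsf{pp},g,C)$ accept is negligible; * *computationally $\ell$-batch evaluation binding* if for all PPT $A$ and $\tilde P$, with $(C_i)_i,x,y,y'\leftarrow A(\mathsf{pp})$, the probability that $y_i\ne y_i'$ for some $i$, while $\tilde P$ convinces the verifier of $\ell\text{-}\mathsf{Eval}$ both on input $((C_i)_i,x,y)$ and on input $((C_i)_i,x,y')$, is negligible. **Protocol.**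 $\mathsf{US}$ is a univariate sumcheck protocol over $H$ with soundness error $p$: for every univariate $g$ with $\deg g\le d$ and every $s\neq\sum_{a\in H}g(a)$, no (unbounded) prover makes the verifier, who has oracle access to $g$, accept the claimed sum $s$ with probability more than $p$. In $\mathsf{Fold}\text{-}\mathsf{DCS}$ instantiated with the PCS and $\mathsf{US}$, the verifier has oracle access to $f\in\mathcal P$ and is given a claimed sum $S\in\mathbb F$; $\mathsf{pp}\leftarrow\mathsf{Setup}(1^\lambda)$ is public. 1. For $i=1,\dots,m$ the prover sends a commitment $C_i$ (to a $2^{m-i}$-variate polynomial $f^{(i)}_0$), and then the verifier sends uniformly random $\alpha^{(i)}\in\mathbb F^{2^{m-i}}$ and $z^{(i)}\in\mathbb F$. 2. The prover sends a commitment $C$ (to a univariate polynomial $f^{(m)}$), and the verifier sends a uniformly random $\beta\in\mathbb F$. The prover sends alleged values $y_i$ of $f^{(i)}_0(\alpha^{(i)})$ and $y'_i$ of $f^{(i)}_0(\alpha^{(i+1)},\dots,\alpha^{(m)},\beta)$ for $1\le i\le m$, and $w$ of $f^{(m)}(\beta)$, and fixes a polynomial $g\in\mathcal P$ as the oracle for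 step 4; $\mathsf{Open}(\mathsf{pp},g,C)$ has to accept. 3. The $\ell=2m+1=2\log_2\mu+1$ alleged values are checked by one run of $\ell\text{-}\mathsf{Eval}$ at the point $(\alpha^{(1)},\dots,\alpha^{(m)},\beta)$, and the verifier checks $w=f(\alpha^{(1)},\dots,\alpha^{(m)},\beta)+\sum_{j=1}^m z^{(j)}y'_j$. 4. $\mathsf{US}$ is run on the univariate polynomial $g(x,0,\dots,0)$ with the claimed sum $\prod_{j=1}^m z^{(j)}\,S+\sum_{j=1}^m\bigl(\prod_{k>j}z^{(k)}\bigr)y_j$. The verifier accepts if all checks succeed; the messages $C_1,\dots,C_m$ are required to be commitments, i.e. values of $\mathsf{Commit}(\mathsf{pp},\cdot)$. **Corollary (computational soundness).** Suppose that the PCS is extractable, computationally binding and computationally $\ell$-batch evaluation binding for the $\ell=2\log_2\mu+1$ evaluations of step 3. Then for every PPT prover $\tilde P$ there are non-negative negligible functions $\varepsilon,\sigma$ such that for all $\lambda$, all $f\in\mathcal P$ and all $S\in\mathbb F$ with $\sum_{a\in H^\mu}f(a)\ne S$, the verifier accepts in interaction with $\tilde P(f,S)$ with probability at most $$(m+1)\varepsilon(\lambda)+1-\left(1-\left(\frac{D+1}{|\mathbb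 F|}-\frac{D}{|\mathbb F|^2}\right)\right)^m\left(1-\max\left(p,\frac{D}{|\mathbb F|}\right)+\sigma(\lambda)\right).$$ If $p\le D/|\mathbb F|$, then this bound is at most $(m+1)\left(\varepsilon(\lambda)+\frac{D+1}{|\mathbb F|}(1+\sigma(\lambda))\right)$ for all $\lambda$. -/

import Mathlib

/-! ### Computation model: randomised programs over binary trees, with a step count -/

/-- Binary trees: the data on which programs act. -/
inductive Dat : Type
  | nil : Dat
  | cons : Dat → Dat → Dat

namespace Dat

/-- Left subtree (`nil` for `nil`). -/
def hd : Dat → Dat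
  | nil => nil
  | cons a _ => a

/-- Right subtree (`nil` for `nil`). -/
def tl : Dat → Dat
  | nil => nil
  | cons _ b => b

/-- Unary numerals. -/
def num : ℕ → Dat
  | 0 => nil
  | n + 1 => cons nil (num n)

/-- A list of trees as a tree. -/
def ofList : List Dat → Dat
  | [] => nil
  | a :: l => cons a (ofList l)

/-- The entry of index `i` of a tree that is read as a list. -/
def nth (t : Dat) (i : ℕ) : Dat := (tl^[i] t).hd

end Dat

/-- Programs of a small functional language on trees (the data operations of the `WHILE` language).
`pair p q` sends `x` to `cons (p x) (q x)`; `comp q p` runs `p` and then `q`; `cond c p q` runs `p`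
if the value of `c` is not `nil`, and `q` otherwise; `rand k` draws a uniform numeral from
`{0, …, k}`; `loop b` replaces `x` by `b x` as long as the left subtree of `x` is not `nil`, and
then returns the right subtree of `x`. -/
inductive Prog : Type
  | id : Prog
  | nil : Prog
  | hd : Prog
  | tl : Prog
  | pair : Prog → Prog → Prog
  | comp : Prog → Prog → Prog
  | cond : Prog → Prog → Prog → Prog
  | rand : ℕ → Prog
  | loop : Prog → Prog

noncomputable section

namespace Prog

/-- The result of an execution: a value and the number of steps, or `none` if it was cut off. -/
abbrev Res := PMF (Option (Dat × ℕ))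

/-- A finished execution with value `y` after `t` steps. -/
def ret (y : Dat) (t : ℕ) : Res := PMF.pure (some (y, t))

/-- Sequencing of executions. -/
def andThen (r : Res) (k : Dat → ℕ → Res) : Res :=
  r.bind fun o => match o with
    | none => PMF.pure none
    | some (y, t) => k y t

/-- At most `N` passes through a loop with body `b`, after `t` steps; each test is one step. -/
def loopExec (b : Dat → Res) : ℕ → Dat → ℕ → Res
  | _, Dat.nil, t => ret Dat.nil (t + 1)
  | _, Dat.cons Dat.nil y, t => ret y (t + 1)
  | 0, Dat.cons (Dat.cons _ _) _, _ => PMF.pure none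
  | N + 1, Dat.cons (Dat.cons u v) y, t =>
      andThen (b (Dat.cons (Dat.cons u v) y)) fun x' s => loopExec b N x' (t + s + 1)

/-- Execution of a program on an input, where no loop may make more than `N` passes: every
operation is one step. An execution of at most `N` steps is never cut off. -/
def exec (N : ℕ) : Prog → Dat → Res
  | id, x => ret x 1
  | nil, _ => ret Dat.nil 1
  | hd, x => ret x.hd 1
  | tl, x => ret x.tl 1
  | pair p q, x =>
      andThen (exec N p x) fun y s => andThen (exec N q x) fun z t => ret (Dat.cons y z) (s + t + 1)
  | comp q p, x =>
      andThen (exec N p x) fun y s => andThen (exec N q y) fun z t => ret z (s + t + 1)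
  | cond c p q, x =>
      andThen (exec N c x) fun y s => match y with
        | Dat.nil => andThen (exec N q x) fun z t => ret z (s + t + 1)
        | Dat.cons _ _ => andThen (exec N p x) fun z t => ret z (s + t + 1)
  | rand k, _ => (PMF.uniformOfFintype (Fin (k + 1))).bind fun i => ret (Dat.num i) 1
  | loop b, x => loopExec (exec N b) N x 0

end Prog

/-- A probabilistic polynomial-time algorithm: a program which, given the security parameter in
unary and any further input, halts within a polynomial number of steps in the security parameter,
whatever its random choices. -/
structure PPT where
  code : Prog
  bound : Polynomial ℕ
  halts : ∀ (sec : ℕ) (x : Dat),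
    ∀ o ∈ (code.exec (bound.eval sec) (Dat.cons (Dat.num sec) x)).support,
      ∃ y t, o = some (y, t) ∧ t ≤ bound.eval sec

/-- The output distribution of an algorithm for security parameter `sec` on input `x`. -/
def PPT.run (A : PPT) (sec : ℕ) (x : Dat) : PMF Dat :=
  (A.code.exec (A.bound.eval sec) (Dat.cons (Dat.num sec) x)).map
    fun o => (o.map Prod.fst).getD Dat.nil

/-- Negligible functions. -/
def Negligible (f : ℕ → ℝ) : Prop :=
  ∀ c : ℕ, 0 < c → ∃ N : ℕ, ∀ n : ℕ, N ≤ n → |f n| < (n : ℝ) ^ (-(c : ℤ))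

/-- The probability of the outcome `true`. -/
def prob (q : PMF Bool) : ℝ := (q true).toReal

/-! ### Interaction -/

/-- `k` moves of a party whose behaviour is given by `step`, which maps a state and an incoming
message to a new state and a reply. The incoming message is `next h`, where `h` is the list of the
earlier replies. The result is the final state and the list of all replies. -/
def talk (step : Dat → PMF Dat) (next : List Dat → Dat) :
    ℕ → Dat → List Dat → PMF (Dat × List Dat)
  | 0, st, h => PMF.pure (st, h)
  | k + 1, st, h =>
      (step (Dat.cons st (next h))).bind fun o => talk step next k o.hd (h ++ [o.tl])

/-- The verifier of an interactive protocol: her coins, the number of rounds, her message as a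
function of her coins and of the replies received so far, and her decision. -/
structure Verifier where
  Coins : Type
  coins : PMF Coins
  rounds : ℕ
  msg : Coins → List Dat → Dat
  accept : Coins → List Dat → Bool

/-- Interaction of a prover in state `st` with a verifier: her decision and his final state. -/
def Verifier.interact (V : Verifier) (step : Dat → PMF Dat) (st : Dat) : PMF (Bool × Dat) :=
  V.coins.bind fun w =>
    (talk step (V.msg w) V.rounds st []).map fun r => (V.accept w r.2, r.1)

/-- The probability that the verifier accepts. -/
def Verifier.acceptProb (V : Verifier) (step : Dat → PMF Dat) (st : Dat) : ℝ :=
  prob ((V.interact step st).map Prod.fst)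

/-- The state in which an interactive algorithm with input `x` begins. -/
def startState (x : Dat) : Dat := Dat.cons Dat.nil x

/-! ### Encodings of finite data and bounded-degree polynomials -/

/-- The elements of a finite type as numerals, in a fixed enumeration. -/
def code {α : Type*} [Fintype α] (a : α) : Dat := Dat.num (Fintype.equivFin α a)

/-- Decoding; `none` for a tree that is not a code. -/
def decode (α : Type*) [Fintype α] : Dat → Option α := Function.partialInv (code (α := α))

/-- Polynomials in `k` variables with partial degrees at most `d` and total degree at most `D`. -/
abbrev BPoly (F : Type*) [Field F] (k d D : ℕ) :=
  {f : MvPolynomial (Fin k) F // (∀ i, f.degreeOf i ≤ d) ∧ f.totalDegree ≤ D}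

section

variable {F : Type*} [Field F] [Fintype F] {k d D : ℕ}

/-- A polynomial is encoded by the table of its coefficients. -/
def codePoly (f : BPoly F k d D) : Dat :=
  code (fun e : Fin k → Fin (d + 1) =>
    f.1.coeff (Finsupp.equivFunOnFinite.symm fun i => (e i : ℕ)))

/-- Decoding of polynomials; `none` for a tree that is not the code of one. -/
def decodePoly (F : Type*) [Field F] [Fintype F] (k d D : ℕ) : Dat → Option (BPoly F k d D) :=
  Function.partialInv codePoly

/-- Points of affine space, encoded. -/
def codeVec (x : Fin k → F) : Dat := code x

/-- Decoding of points. -/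
def decodeVec (F : Type*) [Fintype F] (k : ℕ) : Dat → Option (Fin k → F) := decode (Fin k → F)

end

/-! ### Polynomial commitment schemes with batched evaluation -/

/-- A placement of the variables: the variable `i` of a polynomial is read at the coordinate `π i`
of a point, or as `0` if `π i = none`. -/
abbrev Placement (k : ℕ) := Fin k → Option (Fin k)

/-- The point at which a polynomial with variables placed by `π` is evaluated. -/
def Placement.point {F : Type*} [Zero F] {k : ℕ} (π : Placement k) (x : Fin k → F) : Fin k → F :=
  fun i => ((π i).map x).getD 0

/-- A `k`-variate `(d, D)`-degree polynomial commitment scheme over `F` that allows batched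
evaluation. The evaluation protocol for `ℓ` commitments `C i`, a common point `x`, alleged
values `y i` and placements `π i` is about the claims that the polynomial committed to in `C i` has
the value `y i` at `(π i).point x`; with the identical placements this is the evaluation at `x`. -/
structure PCS (F : Type*) [Field F] [Fintype F] (k d D : ℕ) where
  setup : ℕ → PMF Dat
  commit : Dat → BPoly F k d D → Dat
  /-- `opens pp f C` decides whether `C` is correctly computed from `f`. -/
  opens : Dat → BPoly F k d D → Dat → Bool
  opens_iff : ∀ pp f C, opens pp f C = true ↔ C = commit pp f
  /-- The verifier, given `sec`, `pp`, the commitments, the point and the alleged values. -/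
  evalV : ∀ {ℓ : ℕ}, (Fin ℓ → Placement k) → ℕ → Dat → (Fin ℓ → Dat) → (Fin k → F) →
    (Fin ℓ → F) → Verifier
  /-- The honest prover. -/
  evalP : ∀ {ℓ : ℕ}, (Fin ℓ → Placement k) → PPT
  rounds_le : ∀ {ℓ : ℕ} (π : Fin ℓ → Placement k), ∃ q : Polynomial ℕ,
    ∀ sec pp C x y, (evalV π sec pp C x y).rounds ≤ q.eval sec
  /-- The honest prover, given the committed polynomials, convinces the verifier of their
  values. -/
  complete : ∀ {ℓ : ℕ} (π : Fin ℓ → Placement k) (sec : ℕ), ∀ pp ∈ (setup sec).support,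
    ∀ (f : Fin ℓ → BPoly F k d D) (x : Fin k → F) (C : Fin ℓ → Dat) (y : Fin ℓ → F),
      (∀ i, C i = commit pp (f i)) →
      (∀ i, y i = MvPolynomial.eval ((π i).point x) (f i).1) →
      (evalV π sec pp C x y).acceptProb ((evalP π).run sec)
        (startState (Dat.cons (Dat.ofList (List.ofFn fun i => codePoly (f i)))
          (Dat.cons pp (Dat.cons (Dat.ofList (List.ofFn C))
            (Dat.cons (codeVec x) (codeVec y)))))) = 1

namespace PCS

variable {F : Type*} [Field F] [Fintype F] {k d D : ℕ} (S : PCS F k d D)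

/-- `C` is a commitment to some polynomial. -/
def IsCommitment (pp C : Dat) : Prop := ∃ g, C = S.commit pp g

open Classical in
/-- Extractability: for every adversary that outputs a tree `C` there is an extractor which, given
`C` and the public parameters, outputs a polynomial; the probability that `C` is a commitment but
the output does not open it is negligible. -/
def Extractable : Prop :=
  ∀ A : PPT, ∃ E : PPT, Negligible fun sec =>
    prob ((S.setup sec).bind fun pp =>
      (A.run sec pp).bind fun C =>
        (E.run sec (Dat.cons C pp)).map fun t =>
          decide (S.IsCommitment pp C ∧
            ¬ ∃ f, decodePoly F k d D t = some f ∧ S.opens pp f C = true))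

open Classical in
/-- Computational binding: no adversary opens a commitment to two different polynomials. -/
def Binding : Prop :=
  ∀ A : PPT, Negligible fun sec =>
    prob ((S.setup sec).bind fun pp =>
      (A.run sec pp).map fun t =>
        decide (∃ f g, decodePoly F k d D t.hd = some f ∧ decodePoly F k d D t.tl.hd = some g ∧
          f ≠ g ∧ S.opens pp f t.tl.tl = true ∧ S.opens pp g t.tl.tl = true))

/-- The interaction of a (cheating) prover with the evaluation verifier, on common input. -/
def evalGame {ℓ : ℕ} (π : Fin ℓ → Placement k) (P : PPT) (sec : ℕ) (pp : Dat) (C : Fin ℓ → Dat)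
    (x : Fin k → F) (y : Fin ℓ → F) : PMF Bool :=
  ((S.evalV π sec pp C x y).interact (P.run sec)
    (startState (Dat.cons pp (Dat.cons (Dat.ofList (List.ofFn C))
      (Dat.cons (codeVec x) (codeVec y)))))).map Prod.fst

open Classical in
/-- Computational `ℓ`-batch evaluation binding: no adversary `A`, `P` finds commitments, a point
and two different tuples of values such that `P` convinces the verifier of both tuples. -/
def BatchEvalBinding {ℓ : ℕ} (π : Fin ℓ → Placement k) : Prop :=
  ∀ A P : PPT, Negligible fun sec =>
    prob ((S.setup sec).bind fun pp =>
      (A.run sec pp).bind fun t =>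
        match decodeVec F k (t.nth 1), decodeVec F ℓ (t.nth 2), decodeVec F ℓ (t.nth 3) with
        | some x, some y, some y' =>
            (S.evalGame π P sec pp (fun i => t.hd.nth i) x y).bind fun b =>
              (S.evalGame π P sec pp (fun i => t.hd.nth i) x y').map fun b' =>
                decide ((∃ i, y i ≠ y' i) ∧ b = true ∧ b' = true)
        | _, _, _ => PMF.pure false)

end PCS

/-! ### Univariate sumcheck -/

/-- The verifier of a univariate sumcheck protocol, with oracle access to a polynomial, for a
claimed sum. -/
abbrev USVerifier (F : Type*) [Field F] := Polynomial F → F → Verifier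

/-- The univariate sumcheck over `H` for polynomials of degree at most `d` has soundness error at
most `p`, against unbounded provers. -/
def USVerifier.HasSoundnessError {F : Type*} [Field F] (US : USVerifier F) (H : Finset F) (d : ℕ)
    (p : ℝ) : Prop :=
  ∀ (g : Polynomial F) (s : F), g.natDegree ≤ d → ∑ a ∈ H, g.eval a ≠ s →
    ∀ (step : Dat → PMF Dat) (st : Dat), (US g s).acceptProb step st ≤ p

/-! ### The protocol Fold-DCS for `2 ^ m`-variate polynomials

All random points of the verifier form one point `X` of `F ^ (2 ^ m)`,
namely `X = (α⁽¹⁾, …, α⁽ᵐ⁾, β)`. Rounds are numbered from `0`: the block of round `j < m` begins at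
the coordinate `2 ^ m - 2 ^ (m - j)` and has length `2 ^ (m - 1 - j)`. -/

/-- The first `len` variables are placed at the coordinates `start, start + 1, …`. -/
def window (k start len : ℕ) : Placement k :=
  fun i => if h : i.val < len ∧ start + i.val < k then some ⟨start + i.val, h.2⟩ else none

/-- Placement of the polynomial of round `j` for its value at the point of round `j`. -/
def blockWindow (m j : ℕ) : Placement (2 ^ m) :=
  window (2 ^ m) (2 ^ m - 2 ^ (m - j)) (2 ^ (m - 1 - j))

/-- Placement of the polynomial of round `j` for its value at the points of all later rounds,
followed by `β`. -/
def tailWindow (m j : ℕ) : Placement (2 ^ m) :=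
  window (2 ^ m) (2 ^ m - 2 ^ (m - 1 - j)) (2 ^ (m - 1 - j))

/-- The placements of the `2 m + 1` evaluations: the values used for the claimed sum, the values
used for the consistency check, and the value at `β` of the final univariate polynomial. -/
def foldPlacement (m : ℕ) : Fin (2 * m + 1) → Placement (2 ^ m) := fun i =>
  if i.val < m then blockWindow m i.val
  else if i.val < 2 * m then tailWindow m (i.val - m)
  else window (2 ^ m) (2 ^ m - 1) 1

/-- The commitments for these evaluations, where `C j` is the commitment of round `j` for `j < m`,
and `C m` is the commitment to the final univariate polynomial. -/
def foldCommitments (m : ℕ) (C : ℕ → Dat) : Fin (2 * m + 1) → Dat := fun i =>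
  if i.val < m then C i.val else if i.val < 2 * m then C (i.val - m) else C m

section

variable {F : Type*} [Field F] [Fintype F]

/-- The message of the verifier before the reply `i` of the prover: nothing for `i = 0`, the random
point and the random scalar of round `i - 1` for `1 ≤ i ≤ m`, and `β` for `i = m + 1`. -/
def foldMsg (m : ℕ) (X : Fin (2 ^ m) → F) (z : Fin m → F) (i : ℕ) : Dat :=
  if i = 0 then Dat.nil
  else if h : i - 1 < m then
    Dat.cons (codeVec ((blockWindow m (i - 1)).point X)) (code (z ⟨i - 1, h⟩))
  else codeVec ((window (2 ^ m) (2 ^ m - 1) 1).point X)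

/-- The claimed sum `∏ⱼ zⱼ S + ∑ⱼ (∏_{l > j} zₗ) yⱼ` of the final univariate polynomial, computed
from the alleged values. -/
def foldSum (m : ℕ) (z : Fin m → F) (S : F) (y : Fin (2 * m + 1) → F) : F :=
  (∏ j, z j) * S + ∑ j : Fin m, (∏ l ∈ Finset.univ.filter (fun l => j < l), z l) *
    y ⟨j.val, by omega⟩

/-- The consistency check of the alleged values at `β`, with `v` the value of `f` at `X`. -/
def foldConsistent (m : ℕ) (z : Fin m → F) (v : F) (y : Fin (2 * m + 1) → F) : Prop :=
  y ⟨2 * m, by omega⟩ = v + ∑ j : Fin m, z j * y ⟨m + j.val, by omega⟩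

/-- The univariate polynomial `g(x, 0, …, 0)`. -/
def toUnivariate {k d D : ℕ} (g : BPoly F k d D) : Polynomial F :=
  MvPolynomial.aeval (fun i : Fin k => if i.val = 0 then Polynomial.X else 0) g.1

variable {m d D : ℕ}

open Classical in
/-- The decision of the verifier of Fold-DCS (oracle access to `f`, claimed sum `S`), instantiated
with a polynomial commitment scheme and a univariate sumcheck, in interaction with the prover `P`.

The prover sends a commitment in each of the `m` rounds, a commitment to the final univariate
polynomial, and, once he knows `β`, the `2 m + 1` alleged values `y` together with the
polynomial `g` that stands behind the oracle of the univariate sumcheck, which has to open the last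
commitment. The alleged values are then checked by the batched evaluation protocol, and finally the
univariate sumcheck is run. The messages sent in the `m` rounds have to be commitments. -/
def foldDCS (pcs : PCS F (2 ^ m) d D) (US : USVerifier F) (P : PPT) (sec : ℕ)
    (f : BPoly F (2 ^ m) d D) (S : F) : PMF Bool :=
  (pcs.setup sec).bind fun pp =>
  (PMF.uniformOfFintype (Fin (2 ^ m) → F)).bind fun X =>
  (PMF.uniformOfFintype (Fin m → F)).bind fun z =>
  (talk (P.run sec) (fun h => foldMsg m X z h.length) (m + 2)
    (startState (Dat.cons pp (Dat.cons (codePoly f) (code S)))) []).bind fun r =>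
  let C : ℕ → Dat := fun j => r.2.getD j Dat.nil
  match decodeVec F (2 * m + 1) (C (m + 1)).hd, decodePoly F (2 ^ m) d D (C (m + 1)).tl with
  | some y, some g =>
      ((pcs.evalV (foldPlacement m) sec pp (foldCommitments m C) X y).interact
        (P.run sec) r.1).bind fun e =>
      ((US (toUnivariate g) (foldSum m z S y)).interact (P.run sec) e.2).map fun u =>
      decide ((∀ j < m, pcs.IsCommitment pp (C j)) ∧ pcs.opens pp g (C m) = true ∧
        foldConsistent m z (MvPolynomial.eval X f.1) y ∧ e.1 = true ∧ u.1 = true)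
  | _, _ => PMF.pure false

end

/-- `1 - (1 - ((D+1)/q - D/q²))ᵐ (1 - max(p, D/q) + σ)` plus `(m+1) ε`. -/
def soundnessBound (m D q : ℕ) (p ε σ : ℝ) : ℝ :=
  (m + 1) * ε + 1 -
    (1 - (((D : ℝ) + 1) / q - D / (q : ℝ) ^ 2)) ^ m * (1 - max p (D / q) + σ)

end

/-! An idealised protocol is sound against unbounded provers, the real protocol exceeds it only on
two kinds of bad events, and each bad event is a game that an efficient adversary plays.

Ideal protocol. The prover is bound to polynomials G_0, …, G_m and sends their true values. Before
round j let c be the claimed sum of the folded polynomial, T the sum of G_j over its cube, and A(α)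
the sum of the folded polynomial over the coordinates after block j, with α inserted in the block.
The next claim reads A(α) + zT = zc + G_j(α). Suppose the current claim is false. If c = T, the
scalar z drops out; A - G_j has degree at most D and its sum over the cube is the true sum minus c,
hence it is not zero, and Schwartz–Zippel gives D/|F|. If c ≠ T, each α admits exactly one z, which
gives 1/|F|. So a false claim becomes true with probability at most D/|F| per round
(`expec_foldTrue_succ_le`). A claim that is still false at the end is accepted with probability at
most max(p, D/|F|), by the same argument for β or by the univariate sumcheck
(`expec_foldPayoff_le`). Induction over the rounds (`expec_talk_foldPayoff_le`) gives a bound that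
already lies below the stated one with σ = 0, since D/|F| ≤ (D+1)/|F| - D/|F|².

Reduction. For each commitment some preimage is chosen, with no regard to efficiency. If the
verifier accepts, then the prover behaved as in the ideal protocol, or the last commitment has a
second opening, or the evaluation protocol accepted false values (`foldVerdict_true_le`).

Negligibility. The field and the degrees are fixed, so the number of polynomials, coins and tuples
of values does not depend on the security parameter. A union bound over all of them is harmless, and
each adversary has its own choice built in. Two openings contradict binding directly
(`negligible_bindingFailure`). For false values the adversary convinces the verifier of the true
values by the honest prover and of the false ones by replaying the conversation; two independent
replays are needed, which costs a square root (`negligible_convinceProb`). The sum of all these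
probabilities is ε. -/

open scoped ENNReal

/-! ### Expectations with respect to probability mass functions -/

section Expectation

variable {α β : Type*}

/-- The expectation of a nonnegative function. -/
noncomputable def expec (p : PMF α) (φ : α → ℝ≥0∞) : ℝ≥0∞ := ∑' a, p a * φ a

theorem expec_pure (a : α) (φ : α → ℝ≥0∞) : expec (PMF.pure a) φ = φ a := by
  classical
  unfold expec
  rw [tsum_eq_single a]
  · simp
  · intro b hb
    simp [PMF.pure_apply_of_ne _ _ hb]

theorem expec_bind (p : PMF α) (f : α → PMF β) (φ : β → ℝ≥0∞) :
    expec (p.bind f) φ = expec p fun a => expec (f a) φ := by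
  unfold expec
  simp only [PMF.bind_apply, ← ENNReal.tsum_mul_right, ← ENNReal.tsum_mul_left]
  rw [ENNReal.tsum_comm]
  simp only [mul_assoc]

theorem expec_map (p : PMF α) (f : α → β) (φ : β → ℝ≥0∞) :
    expec (p.map f) φ = expec p fun a => φ (f a) := by
  simp [PMF.map, expec_bind, expec_pure]

theorem expec_mono_support {p : PMF α} {φ ψ : α → ℝ≥0∞} (h : ∀ a ∈ p.support, φ a ≤ ψ a) :
    expec p φ ≤ expec p ψ := by
  refine ENNReal.tsum_le_tsum fun a => ?_
  by_cases ha : a ∈ p.support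
  · gcongr
    exact h a ha
  · rw [PMF.mem_support_iff, not_not] at ha
    simp [ha]

theorem expec_congr_support {p : PMF α} {φ ψ : α → ℝ≥0∞} (h : ∀ a ∈ p.support, φ a = ψ a) :
    expec p φ = expec p ψ :=
  le_antisymm (expec_mono_support fun a ha => (h a ha).le)
    (expec_mono_support fun a ha => (h a ha).ge)

theorem expec_mono {p : PMF α} {φ ψ : α → ℝ≥0∞} (h : ∀ a, φ a ≤ ψ a) : expec p φ ≤ expec p ψ :=
  expec_mono_support fun a _ => h a

theorem expec_const (p : PMF α) (c : ℝ≥0∞) : expec p (fun _ => c) = c := by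
  simp [expec, ENNReal.tsum_mul_right, p.tsum_coe]

theorem expec_le_of_support {p : PMF α} {φ : α → ℝ≥0∞} {c : ℝ≥0∞}
    (h : ∀ a ∈ p.support, φ a ≤ c) : expec p φ ≤ c :=
  (expec_mono_support h).trans_eq (expec_const p c)

theorem expec_le {p : PMF α} {φ : α → ℝ≥0∞} {c : ℝ≥0∞} (h : ∀ a, φ a ≤ c) : expec p φ ≤ c :=
  expec_le_of_support fun a _ => h a

theorem expec_add (p : PMF α) (φ ψ : α → ℝ≥0∞) :
    expec p (fun a => φ a + ψ a) = expec p φ + expec p ψ := by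
  simp [expec, mul_add, ENNReal.tsum_add]

theorem expec_mul_right (p : PMF α) (φ : α → ℝ≥0∞) (c : ℝ≥0∞) :
    expec p (fun a => φ a * c) = expec p φ * c := by
  simp [expec, ← mul_assoc, ENNReal.tsum_mul_right]

theorem expec_mul_left (p : PMF α) (φ : α → ℝ≥0∞) (c : ℝ≥0∞) :
    expec p (fun a => c * φ a) = c * expec p φ := by
  simp only [mul_comm c, expec_mul_right]

theorem expec_finset_sum {ι : Type*} (s : Finset ι) (p : PMF α) (φ : ι → α → ℝ≥0∞) :
    expec p (fun a => ∑ i ∈ s, φ i a) = ∑ i ∈ s, expec p (φ i) := by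
  classical
  induction s using Finset.induction_on with
  | empty => simp [expec]
  | insert i s hi ih => simp only [Finset.sum_insert hi, expec_add, ih]

theorem expec_comm (p : PMF α) (q : PMF β) (φ : α → β → ℝ≥0∞) :
    expec p (fun a => expec q (φ a)) = expec q fun b => expec p fun a => φ a b := by
  simp only [expec, ← ENNReal.tsum_mul_left]
  rw [ENNReal.tsum_comm]
  refine tsum_congr fun b => tsum_congr fun a => ?_
  ring

theorem expec_uniform [Fintype α] [Nonempty α] (φ : α → ℝ≥0∞) :
    expec (PMF.uniformOfFintype α) φ = (Fintype.card α : ℝ≥0∞)⁻¹ * ∑ a, φ a := by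
  simp [expec, tsum_fintype, Finset.mul_sum]

/-- Crude, but it leaves a separate term for each value of the coins, and an adversary can have that
value built in. The lost factor is the number of coins, a constant. -/
theorem expec_uniform_le_sum [Fintype α] [Nonempty α] (φ : α → ℝ≥0∞) :
    expec (PMF.uniformOfFintype α) φ ≤ ∑ a, φ a := by
  rw [expec_uniform]
  refine mul_le_of_le_one_left' ?_
  rw [ENNReal.inv_le_one]
  exact_mod_cast Fintype.card_pos

theorem ENNReal.two_mul_mul_le_add_sq (a b : ℝ≥0∞) : 2 * (a * b) ≤ a ^ 2 + b ^ 2 := by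
  rcases eq_or_ne a ⊤ with rfl | ha
  · simp
  rcases eq_or_ne b ⊤ with rfl | hb
  · simp
  lift a to NNReal using ha
  lift b to NNReal using hb
  norm_cast
  have := two_mul_le_add_sq a b
  rwa [mul_assoc] at this

/-- Jensen's inequality for the square. -/
theorem expec_sq_le (p : PMF α) (φ : α → ℝ≥0∞) :
    expec p φ ^ 2 ≤ expec p fun a => φ a ^ 2 := by
  have h : 2 * expec p φ ^ 2 ≤ 2 * expec p fun a => φ a ^ 2 := by
    -- The square of the expectation is the expectation of `φ a * φ b` over two independent copies.
    calc 2 * expec p φ ^ 2 = expec p fun a => expec p fun b => 2 * (φ a * φ b) := by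
          simp only [expec_mul_left, expec_mul_right, sq]
      _ ≤ expec p fun a => expec p fun b => φ a ^ 2 + φ b ^ 2 :=
          expec_mono fun a => expec_mono fun b => ENNReal.two_mul_mul_le_add_sq _ _
      _ = 2 * expec p fun a => φ a ^ 2 := by
          simp only [expec_add, expec_const, two_mul]
  exact (ENNReal.mul_le_mul_iff_right (by simp) (by simp)).1 h

/-- The probability of `true` as an expectation. -/
theorem apply_true_eq_expec (q : PMF Bool) : q true = expec q fun b => if b = true then 1 else 0 := by
  simp [expec]

theorem prob_eq_expec (q : PMF Bool) :
    prob q = (expec q fun b => if b = true then 1 else 0).toReal := by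
  rw [prob, apply_true_eq_expec]

end Expectation

/-! ### Negligible functions -/

theorem Negligible.zero : Negligible fun _ => 0 := by
  intro c _
  refine ⟨1, fun n hn => ?_⟩
  rw [abs_zero]
  have : (0 : ℝ) < n := by exact_mod_cast hn
  positivity

theorem Negligible.mono {f g : ℕ → ℝ} (hg : Negligible g) (h : ∀ n, |f n| ≤ g n) :
    Negligible f := by
  intro c hc
  obtain ⟨N, hN⟩ := hg c hc
  exact ⟨N, fun n hn => ((h n).trans (le_abs_self _)).trans_lt (hN n hn)⟩

theorem Negligible.add {f g : ℕ → ℝ} (hf : Negligible f) (hg : Negligible g) :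
    Negligible fun n => f n + g n := by
  intro c hc
  obtain ⟨N, hN⟩ := hf (c + 1) (by omega)
  obtain ⟨M, hM⟩ := hg (c + 1) (by omega)
  refine ⟨max 2 (max N M), fun n hn => ?_⟩
  have h2 : (2 : ℝ) ≤ n := by exact_mod_cast (le_max_left _ _).trans hn
  have hpos : (0 : ℝ) < n := by linarith
  have hf' := hN n (by omega)
  have hg' := hM n (by omega)
  have e : (n : ℝ) ^ (-(c : ℤ)) = n * (n : ℝ) ^ (-((c + 1 : ℕ) : ℤ)) := by
    rw [← zpow_one_add₀ hpos.ne']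
    congr 1
    push_cast
    ring
  have hp : (0 : ℝ) < (n : ℝ) ^ (-((c + 1 : ℕ) : ℤ)) := by positivity
  rw [e]
  calc |f n + g n| ≤ |f n| + |g n| := abs_add_le _ _
    _ < 2 * (n : ℝ) ^ (-((c + 1 : ℕ) : ℤ)) := by linarith
    _ ≤ _ := by gcongr

theorem Negligible.sum {ι : Type*} (s : Finset ι) {f : ι → ℕ → ℝ}
    (h : ∀ i ∈ s, Negligible (f i)) : Negligible fun n => ∑ i ∈ s, f i n := by
  classical
  induction s using Finset.induction_on with
  | empty => simpa using Negligible.zero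
  | insert i s hi ih =>
    simp only [Finset.sum_insert hi]
    exact (h i (by simp)).add (ih fun j hj => h j (by simp [hj]))

/-- The adversary against batched evaluation succeeds only with the square of the probability that
has to be bounded. -/
theorem Negligible.sqrt {f : ℕ → ℝ} (hf : Negligible f) : Negligible fun n => √(f n) := by
  intro c hc
  obtain ⟨N, hN⟩ := hf (2 * c) (by omega)
  refine ⟨max 1 N, fun n hn => ?_⟩
  have hpos : (0 : ℝ) < n := by exact_mod_cast (le_max_left 1 N).trans hn
  rw [abs_of_nonneg (Real.sqrt_nonneg _), Real.sqrt_lt' (by positivity)]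
  refine (le_abs_self _).trans_lt ((hN n (by omega)).trans_eq ?_)
  rw [← zpow_natCast, ← zpow_mul]
  congr 1
  push_cast
  ring

/-! ### Efficiently computable randomised functions -/

namespace Prog

theorem mem_support_andThen {r : Res} {k : Dat → ℕ → Res} {o : Option (Dat × ℕ)} :
    o ∈ (andThen r k).support ↔
      (none ∈ r.support ∧ o = none) ∨ ∃ y t, some (y, t) ∈ r.support ∧ o ∈ (k y t).support := by
  rw [andThen, PMF.mem_support_bind_iff]
  constructor
  · rintro ⟨a, ha, ho⟩
    rcases a with _ | ⟨y, t⟩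
    · exact Or.inl ⟨ha, by simpa using ho⟩
    · exact Or.inr ⟨y, t, ha, ho⟩
  · rintro (⟨h, rfl⟩ | ⟨y, t, h, ho⟩)
    · exact ⟨none, h, by simp⟩
    · exact ⟨some (y, t), h, ho⟩

theorem bind_congr_support {α β : Type*} {p : PMF α} {f g : α → PMF β}
    (h : ∀ a ∈ p.support, f a = g a) : p.bind f = p.bind g := by
  ext b
  rw [PMF.bind_apply, PMF.bind_apply]
  refine tsum_congr fun a => ?_
  by_cases ha : a ∈ p.support
  · rw [h a ha]
  · rw [PMF.mem_support_iff, not_not] at ha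
    simp [ha]

/-- A cut-off in either part cuts off the whole execution, so its absence passes to both parts,
where the hypotheses apply. -/
theorem andThen_congr {r r' : Res} {k k' : Dat → ℕ → Res} (hn : none ∉ (andThen r k).support)
    (hr : none ∉ r.support → r' = r)
    (hk : ∀ y t, none ∉ (k y t).support → k' y t = k y t) : andThen r' k' = andThen r k := by
  have h1 : none ∉ r.support := fun h => hn (mem_support_andThen.2 (Or.inl ⟨h, rfl⟩))
  rw [hr h1]
  refine bind_congr_support fun o ho => ?_
  rcases o with _ | ⟨y, t⟩
  · rfl
  · exact hk y t fun h => hn (mem_support_andThen.2 (Or.inr ⟨y, t, ho, h⟩))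

theorem loopExec_eq_of_le {b b' : Dat → Res} (hb : ∀ x, none ∉ (b x).support → b' x = b x) :
    ∀ {N N' : ℕ}, N ≤ N' → ∀ x t, none ∉ (loopExec b N x t).support →
      loopExec b' N' x t = loopExec b N x t
  | _, _, _, Dat.nil, t, _ => by simp [loopExec]
  | _, _, _, Dat.cons Dat.nil y, t, _ => by simp [loopExec]
  | 0, _, _, Dat.cons (Dat.cons _ _) _, t, h => by simp [loopExec] at h
  | N + 1, N' + 1, hN, Dat.cons (Dat.cons u v) y, t, h => by
    rw [loopExec] at h ⊢
    rw [loopExec]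
    exact andThen_congr h (hb _) fun x' s hs =>
      loopExec_eq_of_le hb (Nat.le_of_succ_le_succ hN) x' _ hs

/-- An execution that is never cut off does not depend on the bound for the loops. -/
theorem exec_eq_of_le {N N' : ℕ} (hN : N ≤ N') :
    ∀ (p : Prog) (x : Dat), none ∉ (exec N p x).support → exec N' p x = exec N p x
  | id, x, _ => rfl
  | nil, x, _ => rfl
  | hd, x, _ => rfl
  | tl, x, _ => rfl
  | rand _, x, _ => rfl
  | pair p q, x, h => by
    rw [exec] at h ⊢
    rw [exec]
    exact andThen_congr h (exec_eq_of_le hN p x) fun y s h' =>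
      andThen_congr h' (exec_eq_of_le hN q x) fun _ _ _ => rfl
  | comp q p, x, h => by
    rw [exec] at h ⊢
    rw [exec]
    exact andThen_congr h (exec_eq_of_le hN p x) fun y s h' =>
      andThen_congr h' (exec_eq_of_le hN q y) fun _ _ _ => rfl
  | cond c p q, x, h => by
    rw [exec] at h ⊢
    rw [exec]
    refine andThen_congr h (exec_eq_of_le hN c x) fun y s h' => ?_
    cases y with
    | nil => exact andThen_congr h' (exec_eq_of_le hN q x) fun _ _ _ => rfl
    | cons => exact andThen_congr h' (exec_eq_of_le hN p x) fun _ _ _ => rfl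
  | loop b, x, h => by
    rw [exec] at h ⊢
    rw [exec]
    exact loopExec_eq_of_le (exec_eq_of_le hN b) hN x 0 h

/-- The value of an outcome. -/
def value (o : Option (Dat × ℕ)) : Dat := (o.map Prod.fst).getD Dat.nil

/-- The execution `r` takes at most `B` steps and its value has the distribution `μ`. -/
def HasLaw (r : Res) (B : ℕ) (μ : PMF Dat) : Prop :=
  (∀ o ∈ r.support, ∃ y t, o = some (y, t) ∧ t ≤ B) ∧ r.map value = μ

theorem hasLaw_ret {y : Dat} {t B : ℕ} (h : t ≤ B) : HasLaw (ret y t) B (PMF.pure y) := by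
  refine ⟨fun o ho => ?_, ?_⟩
  · rw [ret, PMF.mem_support_pure_iff] at ho
    exact ⟨y, t, ho, h⟩
  · rw [ret, PMF.pure_map]
    rfl

/-- The continuation is told the time already spent, so `B'` bounds the total time. -/
theorem HasLaw.andThen {r : Res} {B B' : ℕ} {μ : PMF Dat} {k : Dat → ℕ → Res}
    {ν : Dat → PMF Dat} (hr : HasLaw r B μ)
    (hk : ∀ y ∈ μ.support, ∀ t ≤ B, HasLaw (k y t) B' (ν y)) : HasLaw (andThen r k) B' (μ.bind ν) := by
  obtain ⟨h1, rfl⟩ := hr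
  refine ⟨fun o ho => ?_, ?_⟩
  · rcases mem_support_andThen.1 ho with ⟨hn, _⟩ | ⟨y, t, hs, ho⟩
    · obtain ⟨_, _, h, _⟩ := h1 _ hn
      simp at h
    · obtain ⟨y', t', h, ht⟩ := h1 _ hs
      obtain ⟨rfl, rfl⟩ : y = y' ∧ t = t' := by simpa using h
      exact (hk y ((PMF.mem_support_map_iff _ _ _).2 ⟨_, hs, rfl⟩) t ht).1 o ho
  · rw [Prog.andThen, PMF.map_bind, PMF.bind_map]
    refine bind_congr_support fun o ho => ?_
    obtain ⟨y, t, rfl, ht⟩ := h1 o ho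
    exact (hk y ((PMF.mem_support_map_iff _ _ _).2 ⟨_, ho, rfl⟩) t ht).2

end Prog

/-- A randomised function computed by a probabilistic polynomial-time algorithm. -/
def Efficient (g : ℕ → Dat → PMF Dat) : Prop := ∃ A : PPT, ∀ sec x, A.run sec x = g sec x

/-- A deterministic function computed by a probabilistic polynomial-time algorithm. -/
def EfficientDet (φ : Dat → Dat) : Prop := Efficient fun _ x => PMF.pure (φ x)

theorem PPT.efficient (A : PPT) : Efficient A.run := ⟨A, fun _ _ => rfl⟩

/-- A subprogram runs under the loop bound of the surrounding program. It is never cut off under its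
own bound, so a larger one changes nothing. -/
theorem PPT.hasLaw (A : PPT) (sec : ℕ) (x : Dat) {N : ℕ} (hN : A.bound.eval sec ≤ N) :
    Prog.HasLaw (A.code.exec N (Dat.cons (Dat.num sec) x)) (A.bound.eval sec) (A.run sec x) := by
  rw [Prog.exec_eq_of_le hN]
  · exact ⟨A.halts sec x, rfl⟩
  · intro h
    obtain ⟨_, _, h', _⟩ := A.halts sec x _ h
    simp at h'

theorem efficient_of_hasLaw {g : ℕ → Dat → PMF Dat} (p : Prog) (B : Polynomial ℕ)
    (h : ∀ sec x N, B.eval sec ≤ N →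
      Prog.HasLaw (p.exec N (Dat.cons (Dat.num sec) x)) (B.eval sec) (g sec x)) :
    Efficient g :=
  ⟨⟨p, B, fun sec x => (h sec x _ le_rfl).1⟩, fun sec x => (h sec x _ le_rfl).2⟩

theorem efficientDet_id : EfficientDet fun x => x :=
  efficient_of_hasLaw Prog.tl 1 fun _ x N _ => Prog.hasLaw_ret (y := x) (by simp)

theorem efficientDet_nil : EfficientDet fun _ => Dat.nil :=
  efficient_of_hasLaw Prog.nil 1 fun _ _ N _ => Prog.hasLaw_ret (by simp)

theorem Efficient.comp {g h : ℕ → Dat → PMF Dat} (hg : Efficient g) (hh : Efficient h) :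
    Efficient fun sec x => (g sec x).bind (h sec) := by
  obtain ⟨A, hA⟩ := hg
  obtain ⟨B, hB⟩ := hh
  -- The second program expects the security parameter in front of its input, so `pair hd` puts it
  -- back. The operations `hd`, `pair` and `comp` account for the 3 extra steps.
  refine efficient_of_hasLaw (Prog.comp B.code (Prog.pair Prog.hd A.code))
    (A.bound + B.bound + 3) fun sec x N hN => ?_
  have e : (A.bound + B.bound + 3).eval sec = A.bound.eval sec + B.bound.eval sec + 3 := by
    simp
  rw [e] at hN ⊢
  have h1 : Prog.HasLaw ((Prog.pair Prog.hd A.code).exec N (Dat.cons (Dat.num sec) x))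
      (A.bound.eval sec + 2) ((g sec x).map fun y => Dat.cons (Dat.num sec) y) := by
    rw [Prog.exec, Prog.exec, ← PMF.pure_bind (Dat.num sec)
      (fun s => (g sec x).map fun y => Dat.cons s y)]
    refine (Prog.hasLaw_ret (le_refl 1)).andThen fun y _ s hs => ?_
    rw [← hA]
    exact (A.hasLaw sec x (by omega)).andThen fun z _ t ht => Prog.hasLaw_ret (by omega)
  rw [Prog.exec]
  have h2 : (g sec x).bind (h sec) = ((g sec x).map fun y => Dat.cons (Dat.num sec) y).bind
      fun y => h sec y.tl := by
    rw [PMF.bind_map]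
    rfl
  rw [h2]
  refine h1.andThen fun y hy s hs => ?_
  obtain ⟨z, -, rfl⟩ := (PMF.mem_support_map_iff _ _ _).1 hy
  rw [← PMF.bind_pure (h sec (Dat.cons (Dat.num sec) z).tl), ← hB]
  exact (B.hasLaw sec z (by omega)).andThen fun w _ t ht => Prog.hasLaw_ret (by omega)

theorem Efficient.cons {g h : ℕ → Dat → PMF Dat} (hg : Efficient g) (hh : Efficient h) :
    Efficient fun sec x => (g sec x).bind fun y => (h sec x).map fun z => Dat.cons y z := by
  obtain ⟨A, hA⟩ := hg
  obtain ⟨B, hB⟩ := hh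
  refine efficient_of_hasLaw (Prog.pair A.code B.code)
    (A.bound + B.bound + 1) fun sec x N hN => ?_
  have e : (A.bound + B.bound + 1).eval sec = A.bound.eval sec + B.bound.eval sec + 1 := by
    simp
  rw [e] at hN ⊢
  rw [Prog.exec, ← hA, ← hB]
  exact (A.hasLaw sec x (by omega)).andThen fun y _ s hs =>
    (B.hasLaw sec x (by omega)).andThen fun z _ t ht => Prog.hasLaw_ret (by omega)

open Classical in
theorem Efficient.ite {φ : Dat → Dat} {g h : ℕ → Dat → PMF Dat} (hφ : EfficientDet φ)
    (hg : Efficient g) (hh : Efficient h) :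
    Efficient fun sec x => if φ x = Dat.nil then h sec x else g sec x := by
  obtain ⟨T, hT⟩ := hφ
  obtain ⟨A, hA⟩ := hg
  obtain ⟨B, hB⟩ := hh
  refine efficient_of_hasLaw (Prog.cond T.code A.code B.code)
    (T.bound + A.bound + B.bound + 1) fun sec x N hN => ?_
  have e : (T.bound + A.bound + B.bound + 1).eval sec =
      T.bound.eval sec + A.bound.eval sec + B.bound.eval sec + 1 := by
    simp
  rw [e] at hN ⊢
  have hl := T.hasLaw sec x (N := N) (by omega)
  rw [hT] at hl
  rw [Prog.exec, ← PMF.pure_bind (φ x) (fun y => if y = Dat.nil then h sec x else g sec x)]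
  refine hl.andThen fun y _ s hs => ?_
  cases y with
  | nil =>
    rw [if_pos rfl, ← PMF.bind_pure (h sec x), ← hB]
    exact (B.hasLaw sec x (by omega)).andThen fun z _ t ht => Prog.hasLaw_ret (by omega)
  | cons =>
    rw [if_neg (by simp), ← PMF.bind_pure (g sec x), ← hA]
    exact (A.hasLaw sec x (by omega)).andThen fun z _ t ht => Prog.hasLaw_ret (by omega)

theorem Efficient.comp_det {φ : Dat → Dat} {h : ℕ → Dat → PMF Dat} (hφ : EfficientDet φ)
    (hh : Efficient h) : Efficient fun sec x => h sec (φ x) := by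
  simpa only [PMF.pure_bind] using Efficient.comp hφ hh

theorem EfficientDet.comp {φ ψ : Dat → Dat} (hψ : EfficientDet ψ) (hφ : EfficientDet φ) :
    EfficientDet fun x => ψ (φ x) :=
  Efficient.comp_det (h := fun _ x => PMF.pure (ψ x)) hφ hψ

theorem Efficient.map {g : ℕ → Dat → PMF Dat} {φ : Dat → Dat} (hg : Efficient g)
    (hφ : EfficientDet φ) : Efficient fun sec x => (g sec x).map φ :=
  hg.comp hφ

theorem EfficientDet.cons {φ ψ : Dat → Dat} (hφ : EfficientDet φ) (hψ : EfficientDet ψ) :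
    EfficientDet fun x => Dat.cons (φ x) (ψ x) := by
  unfold EfficientDet
  simpa only [PMF.pure_bind, PMF.pure_map] using Efficient.cons hφ hψ

/-- Any fixed tree can be built into a program, however it was found. This is how adversaries come
by polynomials, coins and alleged values. -/
theorem efficientDet_const : ∀ c : Dat, EfficientDet fun _ => c
  | Dat.nil => efficientDet_nil
  | Dat.cons a b => (efficientDet_const a).cons (efficientDet_const b)

theorem efficientDet_hd : EfficientDet Dat.hd := by
  refine efficient_of_hasLaw (Prog.comp Prog.hd Prog.tl) 3 fun sec x N _ => ?_
  rw [Prog.exec, Prog.exec, ← PMF.pure_bind x (fun y => PMF.pure y.hd)]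
  refine (Prog.hasLaw_ret (le_refl 1)).andThen fun y _ s hs => ?_
  rw [Prog.exec, ← PMF.pure_bind y.hd PMF.pure]
  refine (Prog.hasLaw_ret (le_refl 1)).andThen fun z _ t ht => Prog.hasLaw_ret ?_
  simp only [Polynomial.eval_ofNat]
  omega

theorem efficientDet_tl : EfficientDet Dat.tl := by
  refine efficient_of_hasLaw (Prog.comp Prog.tl Prog.tl) 3 fun sec x N _ => ?_
  rw [Prog.exec, Prog.exec, ← PMF.pure_bind x (fun y => PMF.pure y.tl)]
  refine (Prog.hasLaw_ret (le_refl 1)).andThen fun y _ s hs => ?_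
  rw [Prog.exec, ← PMF.pure_bind y.tl PMF.pure]
  refine (Prog.hasLaw_ret (le_refl 1)).andThen fun z _ t ht => Prog.hasLaw_ret ?_
  simp only [Polynomial.eval_ofNat]
  omega

theorem EfficientDet.hd {φ : Dat → Dat} (hφ : EfficientDet φ) : EfficientDet fun x => (φ x).hd :=
  efficientDet_hd.comp hφ

theorem EfficientDet.tl {φ : Dat → Dat} (hφ : EfficientDet φ) : EfficientDet fun x => (φ x).tl :=
  efficientDet_tl.comp hφ

theorem EfficientDet.nth {φ : Dat → Dat} (hφ : EfficientDet φ) (i : ℕ) :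
    EfficientDet fun x => (φ x).nth i := by
  induction i generalizing φ with
  | zero => exact hφ.hd
  | succ i ih => exact ih hφ.tl

theorem EfficientDet.ofList : ∀ {l : List (Dat → Dat)}, (∀ φ ∈ l, EfficientDet φ) →
    EfficientDet fun x => Dat.ofList (l.map fun φ => φ x)
  | [], _ => efficientDet_nil
  | φ :: l, h => (h φ (by simp)).cons (EfficientDet.ofList (l := l) fun ψ hψ => h ψ (by simp [hψ]))

open Classical in
theorem EfficientDet.ite {φ ψ χ : Dat → Dat} (hφ : EfficientDet φ) (hψ : EfficientDet ψ)
    (hχ : EfficientDet χ) : EfficientDet fun x => if φ x = Dat.nil then χ x else ψ x := by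
  have h := Efficient.ite hφ hψ hχ
  refine (congrArg Efficient ?_).mp h
  funext sec x
  by_cases h0 : φ x = Dat.nil <;> simp [h0]

open Classical in
/-- Comparison with a fixed tree. -/
theorem efficientDet_eq : ∀ c : Dat,
    EfficientDet fun x => if x = c then Dat.cons Dat.nil Dat.nil else Dat.nil
  | Dat.nil => by
    have h := EfficientDet.ite efficientDet_id efficientDet_nil
      (efficientDet_const (Dat.cons Dat.nil Dat.nil))
    exact h
  | Dat.cons a b => by
    have h := EfficientDet.ite efficientDet_id
      (EfficientDet.ite ((efficientDet_eq a).comp efficientDet_hd)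
        ((efficientDet_eq b).comp efficientDet_tl) efficientDet_nil) efficientDet_nil
    refine (congrArg EfficientDet ?_).mp h
    funext x
    cases x with
    | nil => simp
    | cons u v => by_cases h1 : u = a <;> by_cases h2 : v = b <;> simp [Dat.hd, Dat.tl, h1, h2]

open Classical in
/-- Branching on equality with a fixed tree. -/
theorem Efficient.ite_eq {φ : Dat → Dat} {g h : ℕ → Dat → PMF Dat} (hφ : EfficientDet φ) (c : Dat)
    (hg : Efficient g) (hh : Efficient h) :
    Efficient fun sec x => if φ x = c then g sec x else h sec x := by
  have h := Efficient.ite ((efficientDet_eq c).comp hφ) hg hh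
  refine (congrArg Efficient ?_).mp h
  funext sec x
  by_cases hc : φ x = c <;> simp [hc]

/-- Sequencing that keeps the input. -/
theorem Efficient.bind {g h : ℕ → Dat → PMF Dat} (hg : Efficient g) (hh : Efficient h) :
    Efficient fun sec x => (g sec x).bind fun y => h sec (Dat.cons x y) := by
  have h := (Efficient.cons efficientDet_id hg).comp hh
  simpa only [PMF.pure_bind, PMF.bind_map, Function.comp_def] using h

/-! ### Simulation of a conversation with fixed messages -/

theorem exists_of_mem_support_talk {step : Dat → PMF Dat} {next : List Dat → Dat} :
    ∀ {k : ℕ} {st : Dat} {h : List Dat} {r : Dat × List Dat},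
      r ∈ (talk step next k st h).support → ∃ l, r.2 = h ++ l ∧ l.length = k
  | 0, st, h, r, hr => by
    rw [talk, PMF.mem_support_pure_iff] at hr
    exact ⟨[], by simp [hr]⟩
  | k + 1, st, h, r, hr => by
    rw [talk, PMF.mem_support_bind_iff] at hr
    obtain ⟨o, -, ho⟩ := hr
    obtain ⟨l, hl, hk⟩ := exists_of_mem_support_talk ho
    exact ⟨o.tl :: l, by simp [hl], by simp [hk]⟩

/-- The definition splits off the first move; a simulation that extends a stored conversation has to
split off the last one. -/
theorem talk_succ (step : Dat → PMF Dat) (next : List Dat → Dat) :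
    ∀ (k : ℕ) (st : Dat) (h : List Dat), talk step next (k + 1) st h =
      (talk step next k st h).bind fun r =>
        (step (Dat.cons r.1 (next r.2))).map fun o => (o.hd, r.2 ++ [o.tl])
  | 0, st, h => by
    simp only [talk, PMF.pure_bind]
    rfl
  | k + 1, st, h => by
    rw [talk, talk, PMF.bind_bind]
    exact congrArg _ (funext fun o => talk_succ step next k _ _)

/-- The final state and the replies, latest first, as a tree. -/
def encodeTalk (r : Dat × List Dat) : Dat := Dat.cons r.1 (Dat.ofList r.2.reverse)

/-- The messages depend only on the number of earlier replies and `k` is fixed, so `k` calls of `P`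
with built-in messages are composed without a loop. -/
theorem efficient_talk (P : PPT) (msgs : ℕ → Dat) {φ : Dat → Dat} (hφ : EfficientDet φ) (k : ℕ) :
    Efficient fun sec x =>
      (talk (P.run sec) (fun h => msgs h.length) k (φ x) []).map encodeTalk := by
  induction k with
  | zero =>
    simp only [talk, PMF.pure_map]
    exact hφ.cons efficientDet_nil
  | succ k ih =>
    have hstep : Efficient fun sec y =>
        (P.run sec (Dat.cons y.hd (msgs k))).bind fun o =>
          PMF.pure (Dat.cons o.hd (Dat.cons o.tl y.tl)) := by
      have h1 : Efficient fun sec y => P.run sec (Dat.cons y.hd (msgs k)) :=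
        Efficient.comp_det (efficientDet_hd.cons (efficientDet_const _)) P.efficient
      have h2 : EfficientDet fun w => Dat.cons w.tl.hd (Dat.cons w.tl.tl w.hd.tl) :=
        efficientDet_tl.hd.cons (efficientDet_tl.tl.cons efficientDet_hd.tl)
      exact h1.bind h2
    refine (congrArg Efficient ?_).mp (ih.comp hstep)
    funext sec x
    rw [talk_succ, PMF.map_bind, PMF.bind_map]
    refine Prog.bind_congr_support fun r hr => ?_
    obtain ⟨l, hl, hk⟩ := exists_of_mem_support_talk hr
    rw [List.nil_append] at hl
    subst hl
    rw [Function.comp_apply, PMF.map_comp, hk]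
    simp only [encodeTalk, Dat.hd, Dat.tl, PMF.map, Function.comp_def, List.reverse_append,
      List.reverse_cons, List.reverse_nil, List.nil_append, List.singleton_append, Dat.ofList]

theorem Dat.nth_ofList : ∀ (l : List Dat) (i : ℕ), (Dat.ofList l).nth i = l.getD i Dat.nil
  | [], i => by
    have : ∀ i, Dat.tl^[i] Dat.nil = Dat.nil := fun i => Function.iterate_fixed rfl i
    simp [Dat.ofList, Dat.nth, this, Dat.hd]
  | a :: l, 0 => rfl
  | a :: l, i + 1 => by
    rw [List.getD_cons_succ, ← Dat.nth_ofList l i]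
    rfl

/-- Access to a reply in the encoding of a conversation. -/
theorem nth_encodeTalk {r : Dat × List Dat} {k i : ℕ} (hr : r.2.length = k + 1) (hi : i ≤ k) :
    (encodeTalk r).tl.nth (k - i) = r.2.getD i Dat.nil := by
  rw [encodeTalk, Dat.tl, Dat.nth_ofList, List.getD_reverse _ (by omega)]
  congr 1
  omega

/-! ### Interactive algorithms that prepare a state and then follow one of two strategies -/

/-- The output of a step, with a tag added to the new state. -/
def tagStep (tag o : Dat) : Dat := Dat.cons (Dat.cons tag o.hd) o.tl

theorem talk_tag {step step' : Dat → PMF Dat} {tag : Dat} (next : List Dat → Dat)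
    (hs : ∀ s msg, step' (Dat.cons (Dat.cons tag s) msg) =
      (step (Dat.cons s msg)).map (tagStep tag)) :
    ∀ (k : ℕ) (s : Dat) (h : List Dat), talk step' next k (Dat.cons tag s) h =
      (talk step next k s h).map fun r => (Dat.cons tag r.1, r.2)
  | 0, s, h => by simp [talk, PMF.pure_map]
  | k + 1, s, h => by
    rw [talk, talk, hs, PMF.bind_map, PMF.map_bind]
    exact congrArg _ (funext fun o => talk_tag next hs k _ _)

/-- Only the replies are compared: the final state carries the tag, and in a conversation without
moves the preparation is never run. -/
theorem talk_prepared {step step' : Dat → PMF Dat} {tag inp : Dat} {prep : PMF Dat}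
    (next : List Dat → Dat)
    (hs : ∀ s msg, step' (Dat.cons (Dat.cons tag s) msg) =
      (step (Dat.cons s msg)).map (tagStep tag))
    (hi : ∀ msg, step' (Dat.cons (startState inp) msg) =
      prep.bind fun s => (step (Dat.cons s msg)).map (tagStep tag)) (k : ℕ) :
    (talk step' next k (startState inp) []).map Prod.snd =
      prep.bind fun s => (talk step next k s []).map Prod.snd := by
  cases k with
  | zero => simp [talk, PMF.pure_map]
  | succ k =>
    simp only [talk]
    rw [hi, PMF.bind_bind, PMF.map_bind]
    refine congrArg _ (funext fun s => ?_)
    rw [PMF.bind_map, PMF.map_bind, PMF.map_bind]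
    refine congrArg _ (funext fun o => ?_)
    simp only [Function.comp_apply, tagStep, Dat.hd, Dat.tl]
    rw [talk_tag next hs, PMF.map_comp]
    rfl

theorem Verifier.interact_map_fst (V : Verifier) (step : Dat → PMF Dat) (st : Dat) :
    (V.interact step st).map Prod.fst = V.coins.bind fun w =>
      ((talk step (V.msg w) V.rounds st []).map Prod.snd).map (V.accept w) := by
  simp only [Verifier.interact, PMF.map_bind, PMF.map_comp]
  rfl

theorem Verifier.interact_prepared {step step' : Dat → PMF Dat} {tag inp : Dat} {prep : PMF Dat}
    (V : Verifier)
    (hs : ∀ s msg, step' (Dat.cons (Dat.cons tag s) msg) =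
      (step (Dat.cons s msg)).map (tagStep tag))
    (hi : ∀ msg, step' (Dat.cons (startState inp) msg) =
      prep.bind fun s => (step (Dat.cons s msg)).map (tagStep tag)) :
    (V.interact step' (startState inp)).map Prod.fst =
      prep.bind fun s => (V.interact step s).map Prod.fst := by
  simp only [Verifier.interact_map_fst, talk_prepared _ hs hi, PMF.map_bind]
  rw [PMF.bind_comm]

/-- Two strategies, each with a preparation of its initial state, can be combined into one
interactive algorithm that chooses between them by comparing a part of its input with a fixed
tree. -/
theorem exists_dispatch {φ : Dat → Dat} (hφ : EfficientDet φ) (c : Dat)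
    {prep₁ prep₂ : ℕ → Dat → PMF Dat} (h₁ : Efficient prep₁) (h₂ : Efficient prep₂)
    (P₁ P₂ : PPT) : ∃ Q : PPT, ∀ (sec : ℕ) (V : Verifier) (inp : Dat),
      (φ inp = c → (V.interact (Q.run sec) (startState inp)).map Prod.fst =
        (prep₁ sec inp).bind fun s => (V.interact (P₁.run sec) s).map Prod.fst) ∧
      (φ inp ≠ c → (V.interact (Q.run sec) (startState inp)).map Prod.fst =
        (prep₂ sec inp).bind fun s => (V.interact (P₂.run sec) s).map Prod.fst) := by
  classical
  -- An initial state has left subtree `nil`. Two distinct trees other than `nil` therefore mark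
  -- that the preparation is done and which strategy is running.
  set tag₁ : Dat := Dat.cons Dat.nil Dat.nil with ht₁
  set tag₂ : Dat := Dat.cons Dat.nil (Dat.cons Dat.nil Dat.nil) with ht₂
  have hwrap : ∀ tag, EfficientDet (tagStep tag) := fun tag =>
    ((efficientDet_const tag).cons efficientDet_hd).cons efficientDet_tl
  have hcont : ∀ (P : PPT) (tag : Dat), Efficient fun sec w =>
      (P.run sec (Dat.cons w.hd.tl w.tl)).map (tagStep tag) := fun P tag =>
    (Efficient.comp_det (efficientDet_hd.tl.cons efficientDet_tl) P.efficient).map (hwrap tag)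
  have hstart : ∀ (P : PPT) (tag : Dat) (prep : ℕ → Dat → PMF Dat), Efficient prep →
      Efficient fun sec w => (prep sec w.hd.tl).bind fun s =>
        (P.run sec (Dat.cons s w.tl)).map (tagStep tag) := fun P tag prep hi =>
    (Efficient.comp_det efficientDet_hd.tl hi).bind
      (h := fun sec v => (P.run sec (Dat.cons v.tl v.hd.tl)).map (tagStep tag))
      ((Efficient.comp_det (efficientDet_tl.cons efficientDet_hd.tl) P.efficient).map (hwrap tag))
  obtain ⟨Q, hQ⟩ := Efficient.ite_eq efficientDet_hd.hd Dat.nil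
    (Efficient.ite_eq (hφ.comp efficientDet_hd.tl) c (hstart P₁ tag₁ prep₁ h₁)
      (hstart P₂ tag₂ prep₂ h₂))
    (Efficient.ite_eq efficientDet_hd.hd tag₁ (hcont P₁ tag₁) (hcont P₂ tag₂))
  refine ⟨Q, fun sec V inp => ⟨fun hc => ?_, fun hc => ?_⟩⟩
  · refine V.interact_prepared (tag := tag₁) (fun s msg => ?_) fun msg => ?_
    · rw [hQ]
      simp [Dat.hd, Dat.tl, ht₁]
    · rw [hQ]
      simp [Dat.hd, Dat.tl, startState, hc]
  · refine V.interact_prepared (tag := tag₂) (fun s msg => ?_) fun msg => ?_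
    · rw [hQ]
      simp [Dat.hd, Dat.tl, ht₁, ht₂]
    · rw [hQ]
      simp [Dat.hd, Dat.tl, startState, hc]

/-! ### Encodings -/

theorem Dat.num_injective : Function.Injective Dat.num := by
  intro a
  induction a with
  | zero => intro b h; cases b with
    | zero => rfl
    | succ b => simp [Dat.num] at h
  | succ a ih => intro b h; cases b with
    | zero => simp [Dat.num] at h
    | succ b =>
      simp only [Dat.num, Dat.cons.injEq, true_and] at h
      rw [ih h]

theorem code_injective {α : Type*} [Fintype α] : Function.Injective (code (α := α)) := by
  intro a b h
  exact (Fintype.equivFin α).injective (Fin.ext (Dat.num_injective h))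

theorem decodeVec_codeVec {F : Type*} [Fintype F] {k : ℕ} (x : Fin k → F) :
    decodeVec F k (codeVec x) = some x :=
  Function.partialInv_left code_injective x

section

variable {F : Type*} [Field F] [Fintype F] {k d D : ℕ}

theorem coeffTable_injective {F : Type*} [Field F] {k d D : ℕ} : Function.Injective fun (f : BPoly F k d D)
    (e : Fin k → Fin (d + 1)) => f.1.coeff (Finsupp.equivFunOnFinite.symm fun i => (e i : ℕ)) := by
  intro f g h
  apply Subtype.ext
  ext s
  by_cases hs : ∀ i, s i ≤ d
  · have := congrFun h fun i => ⟨s i, Nat.lt_succ_of_le (hs i)⟩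
    have e : (Finsupp.equivFunOnFinite.symm fun i => s i) = s := by ext i; rfl
    simpa only [e] using this
  · push Not at hs
    obtain ⟨i, hi⟩ := hs
    have key : ∀ p : BPoly F k d D, p.1.coeff s = 0 := by
      intro p
      by_contra hne
      exact absurd ((MvPolynomial.monomial_le_degreeOf i
        (MvPolynomial.mem_support_iff.2 hne)).trans (p.2.1 i)) (by omega)
    rw [key, key]

theorem codePoly_injective : Function.Injective (codePoly : BPoly F k d D → Dat) := fun _ _ h =>
  coeffTable_injective (code_injective h)

theorem decodePoly_codePoly (f : BPoly F k d D) : decodePoly F k d D (codePoly f) = some f :=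
  Function.partialInv_left codePoly_injective f

/-- This allows union bounds over all polynomials with a number of terms that does not depend on the
security parameter. -/
instance BPoly.finite : Finite (BPoly F k d D) := Finite.of_injective _ coeffTable_injective

end

/-! ### The bad events of Fold-DCS have negligible probability -/

/-- The round whose commitment is used in the evaluation `i`. -/
def foldIndex (m : ℕ) (i : Fin (2 * m + 1)) : Fin (m + 1) :=
  ⟨if i.val < m then i.val else if i.val < 2 * m then i.val - m else m, by split_ifs <;> omega⟩

theorem foldCommitments_eq (m : ℕ) (C : ℕ → Dat) (i : Fin (2 * m + 1)) :
    foldCommitments m C i = C (foldIndex m i) := by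
  unfold foldCommitments foldIndex
  dsimp only
  split_ifs <;> rfl

section

variable {F : Type*} [Field F] [Fintype F] {m d D : ℕ}

/-- The conversation of Fold-DCS up to the alleged values, for fixed coins of the verifier. -/
noncomputable def foldTalk (P : PPT) (sec : ℕ) (f : BPoly F (2 ^ m) d D) (S : F)
    (X : Fin (2 ^ m) → F) (z : Fin m → F) (pp : Dat) : PMF (Dat × List Dat) :=
  talk (P.run sec) (fun h => foldMsg m X z h.length) (m + 2)
    (startState (Dat.cons pp (Dat.cons (codePoly f) (code S)))) []

theorem length_of_mem_support_foldTalk {P : PPT} {sec : ℕ} {f : BPoly F (2 ^ m) d D} {S : F}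
    {X : Fin (2 ^ m) → F} {z : Fin m → F} {pp : Dat} {r : Dat × List Dat}
    (hr : r ∈ (foldTalk P sec f S X z pp).support) : r.2.length = m + 1 + 1 := by
  obtain ⟨l, hl, hk⟩ := exists_of_mem_support_talk hr
  simp [hl, hk]

theorem efficient_foldTalk (P : PPT) (f : BPoly F (2 ^ m) d D) (S : F)
    (X : Fin (2 ^ m) → F) (z : Fin m → F) :
    Efficient fun sec pp => (foldTalk P sec f S X z pp).map encodeTalk :=
  efficient_talk P (foldMsg m X z)
    (efficientDet_nil.cons (efficientDet_id.cons (efficientDet_const _))) (m + 2)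

variable (pcs : PCS F (2 ^ m) d D) (P : PPT) (f : BPoly F (2 ^ m) d D) (S : F)
  (X : Fin (2 ^ m) → F) (z : Fin m → F)

open Classical in
/-- The probability that both `g₁` and `g₂` open the last commitment. -/
noncomputable def bindingFailure (g₁ g₂ : BPoly F (2 ^ m) d D) (sec : ℕ) : ℝ≥0∞ :=
  expec (pcs.setup sec) fun pp => expec (foldTalk P sec f S X z pp) fun r =>
    if r.2.getD m Dat.nil = pcs.commit pp g₁ ∧ r.2.getD m Dat.nil = pcs.commit pp g₂ then 1 else 0

/-- The adversary replays the conversation with `X` and `z` built in and outputs the built-in `g₁`,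
`g₂` with the last commitment; its success probability is exactly the quantity in question. -/
theorem negligible_bindingFailure (hbind : pcs.Binding) {g₁ g₂ : BPoly F (2 ^ m) d D}
    (hne : g₁ ≠ g₂) : Negligible fun sec => (bindingFailure pcs P f S X z g₁ g₂ sec).toReal := by
  classical
  -- The `m + 2` replies are stored latest first, so the reply of index `m` is at position 1.
  have hout : EfficientDet fun t => Dat.cons (codePoly g₁) (Dat.cons (codePoly g₂) (t.tl.nth 1)) :=
    (efficientDet_const _).cons ((efficientDet_const _).cons (efficientDet_tl.nth 1))
  obtain ⟨A, hA⟩ := (efficient_foldTalk P f S X z).map hout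
  refine (congrArg Negligible ?_).mp (hbind A)
  funext sec
  rw [prob_eq_expec, expec_bind, bindingFailure]
  congr 1
  refine congrArg _ (funext fun pp => ?_)
  rw [expec_map, hA, expec_map, expec_map]
  refine expec_congr_support fun r hr => ?_
  have hn := nth_encodeTalk (length_of_mem_support_foldTalk hr) (i := m) (by omega)
  rw [Nat.add_sub_cancel_left] at hn
  have hdtl : ∀ a b : Dat, (Dat.cons a b).hd = a ∧ (Dat.cons a b).tl = b := fun _ _ => ⟨rfl, rfl⟩
  simp only [hn, hdtl, decodePoly_codePoly, pcs.opens_iff, Option.some.injEq, decide_eq_true_eq]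
  refine if_congr ⟨?_, fun h => ⟨g₁, g₂, rfl, rfl, hne, h⟩⟩ rfl rfl
  rintro ⟨_, _, rfl, rfl, -, h⟩
  exact h

/-- The true values of the polynomials `G` in the evaluations of Fold-DCS. -/
noncomputable def foldValues (G : Fin (m + 1) → BPoly F (2 ^ m) d D) : Fin (2 * m + 1) → F :=
  fun i => MvPolynomial.eval ((foldPlacement m i).point X) (G (foldIndex m i)).1

/-- The replies of the prover. -/
def reply (r : Dat × List Dat) (j : ℕ) : Dat := r.2.getD j Dat.nil

/-- The probability that the evaluation protocol accepts the values `y` after the conversation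
`r`. -/
noncomputable def evalAccept (sec : ℕ) (pp : Dat) (r : Dat × List Dat) (y : Fin (2 * m + 1) → F) :
    ℝ≥0∞ :=
  ((pcs.evalV (foldPlacement m) sec pp (foldCommitments m (reply r)) X y).interact
    (P.run sec) r.1).map Prod.fst true

open Classical in
/-- The probability, for given public parameters, that the prover commits to the polynomials `G`
and convinces the verifier of the values `y`. -/
noncomputable def convinceProb (G : Fin (m + 1) → BPoly F (2 ^ m) d D) (y : Fin (2 * m + 1) → F)
    (sec : ℕ) (pp : Dat) : ℝ≥0∞ :=
  expec (foldTalk P sec f S X z pp) fun r =>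
    if (∀ j : Fin (m + 1), reply r j = pcs.commit pp (G j)) ∧
        decodeVec F (2 * m + 1) (reply r (m + 1)).hd = some y then
      evalAccept pcs P X sec pp r y else 0

theorem expec_and (q q' : PMF Bool) :
    (q.bind fun b => q'.map fun b' => decide (b = true ∧ b' = true)) true = q true * q' true := by
  rw [apply_true_eq_expec, expec_bind, apply_true_eq_expec q, ← expec_mul_right]
  refine congrArg _ (funext fun b => ?_)
  rw [expec_map, apply_true_eq_expec q']
  cases b <;> simp [expec_const]

/-- `A` replays the conversation and offers both the true values of `G` and `y`. `Q` recognises the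
true values in its input and is then the honest prover with `G` built in; otherwise it replays the
conversation afresh and continues as `P`. The two replays are independent, but since `commit` is a
function, their commitments coincide whenever both commit to `G`. -/
theorem exists_evalAdversary {G : Fin (m + 1) → BPoly F (2 ^ m) d D} {y : Fin (2 * m + 1) → F}
    (hy : y ≠ foldValues X G) : ∃ A Q : PPT,
      (∀ sec pp, A.run sec pp = (foldTalk P sec f S X z pp).map fun r =>
        Dat.ofList [Dat.ofList (List.ofFn (foldCommitments m (reply r))), codeVec X,
          codeVec (foldValues X G), codeVec y]) ∧
      ∀ sec, ∀ pp ∈ (pcs.setup sec).support, ∀ r : Dat × List Dat,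
        (∀ j : Fin (m + 1), reply r j = pcs.commit pp (G j)) →
        convinceProb pcs P f S X z G y sec pp ≤
          (pcs.evalGame (foldPlacement m) Q sec pp (foldCommitments m (reply r)) X
            (foldValues X G)) true *
          (pcs.evalGame (foldPlacement m) Q sec pp (foldCommitments m (reply r)) X y) true := by
  classical
  set v := foldValues X G with hv
  have hout : EfficientDet fun t => Dat.ofList [Dat.ofList (List.ofFn
      fun i : Fin (2 * m + 1) => t.tl.nth (m + 1 - foldIndex m i)), codeVec X, codeVec v,
        codeVec y] := by
    have h1 : EfficientDet fun t => Dat.ofList (List.ofFn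
        fun i : Fin (2 * m + 1) => t.tl.nth (m + 1 - foldIndex m i)) := by
      have := EfficientDet.ofList (l := List.ofFn fun (i : Fin (2 * m + 1)) (t : Dat) =>
        t.tl.nth (m + 1 - foldIndex m i)) (by
          intro φ hφ
          obtain ⟨i, rfl⟩ := (List.mem_ofFn' _ _).1 hφ
          exact efficientDet_tl.nth _)
      simpa only [List.map_ofFn, Function.comp_def] using this
    exact h1.cons (efficientDet_const _)
  obtain ⟨A, hA⟩ := (efficient_foldTalk P f S X z).map hout
  obtain ⟨Q, hQ⟩ := exists_dispatch (efficientDet_tl.tl.tl) (codeVec v)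
    (prep₁ := fun _ inp => PMF.pure (startState (Dat.cons (Dat.ofList (List.ofFn
      fun i => codePoly (G (foldIndex m i)))) inp)))
    (prep₂ := fun sec inp => ((foldTalk P sec f S X z inp.hd).map encodeTalk).map Dat.hd)
    (efficientDet_nil.cons ((efficientDet_const _).cons efficientDet_id))
    ((Efficient.comp_det efficientDet_hd (efficient_foldTalk P f S X z)).map efficientDet_hd)
    (pcs.evalP (foldPlacement m)) P
  refine ⟨A, Q, fun sec pp => ?_, fun sec pp hpp r hC => ?_⟩
  · rw [hA]
    dsimp only
    rw [PMF.map_comp]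
    refine Prog.bind_congr_support fun r hr => ?_
    have h : (fun i : Fin (2 * m + 1) => (encodeTalk r).tl.nth (m + 1 - foldIndex m i)) =
        foldCommitments m (reply r) := by
      funext i
      rw [foldCommitments_eq, reply,
        ← nth_encodeTalk (length_of_mem_support_foldTalk hr) (by omega)]
    simp only [Function.comp_apply, h]
  · have hC' : foldCommitments m (reply r) = fun i => pcs.commit pp (G (foldIndex m i)) := by
      funext i
      rw [foldCommitments_eq, hC]
    have h1 : (pcs.evalGame (foldPlacement m) Q sec pp (foldCommitments m (reply r)) X v) true
        = 1 := by
      have hc := pcs.complete (foldPlacement m) sec pp hpp (fun i => G (foldIndex m i)) X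
        (fun i => pcs.commit pp (G (foldIndex m i))) v (fun _ => rfl) (fun _ => rfl)
      rw [Verifier.acceptProb, prob, ENNReal.toReal_eq_one_iff] at hc
      rw [PCS.evalGame, (hQ sec _ _).1 rfl, PMF.pure_bind, hC']
      exact hc
    have hcode : ∀ a b c : Dat, (Dat.cons a (Dat.cons b (Dat.cons c (codeVec y)))).tl.tl.tl ≠
        codeVec v := fun _ _ _ h => hy (code_injective h)
    rw [h1, one_mul, PCS.evalGame, (hQ sec _ _).2 (hcode _ _ _), PMF.map_comp, PMF.bind_map,
      PMF.bind_apply]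
    refine ENNReal.tsum_le_tsum fun r' => mul_le_mul' le_rfl ?_
    dsimp only
    split_ifs with h
    · have : foldCommitments m (reply r') = foldCommitments m (reply r) := by
        funext i
        rw [foldCommitments_eq, foldCommitments_eq, h.1, hC]
      rw [evalAccept, this]
      exact le_rfl
    · exact zero_le

/-- For fixed parameters let w be the probability in question. The replay of `A` commits to `G` with
probability at least w, and then `Q` convinces the verifier of both tuples with probability at least
w. So the advantage is at least E[w²] ≥ E[w]². -/
theorem negligible_convinceProb (heval : pcs.BatchEvalBinding (foldPlacement m))
    {G : Fin (m + 1) → BPoly F (2 ^ m) d D} {y : Fin (2 * m + 1) → F}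
    (hy : y ≠ foldValues X G) : Negligible fun sec =>
      (expec (pcs.setup sec) (convinceProb pcs P f S X z G y sec)).toReal := by
  classical
  obtain ⟨A, Q, hA, hQ⟩ := exists_evalAdversary pcs P f S X z hy
  refine (heval A Q).sqrt.mono fun sec => ?_
  rw [abs_of_nonneg ENNReal.toReal_nonneg]
  refine Real.le_sqrt_of_sq_le ?_
  rw [← ENNReal.toReal_pow, prob]
  refine ENNReal.toReal_mono (PMF.apply_ne_top _ _) ?_
  rw [apply_true_eq_expec, expec_bind]
  refine (expec_sq_le _ _).trans (expec_mono_support fun pp hpp => ?_)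
  rw [expec_bind, hA, expec_map]
  set w := convinceProb pcs P f S X z G y sec pp with hw
  calc w ^ 2 = w * w := sq w
    _ ≤ (expec (foldTalk P sec f S X z pp) fun r =>
          if ∀ j : Fin (m + 1), reply r j = pcs.commit pp (G j) then 1 else 0) * w := by
        refine mul_le_mul' (expec_mono fun r => ?_) le_rfl
        split_ifs with h1 h2 h2
        · exact PMF.coe_le_one _ _
        · exact absurd h1.1 h2
        · exact zero_le
        · exact le_rfl
    _ ≤ _ := by
        rw [← expec_mul_right]
        refine expec_mono fun r => ?_
        split_ifs with hC
        swap
        · simp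
        rw [one_mul]
        refine (hQ sec pp hpp r hC).trans ?_
        have hl : (fun i : Fin (2 * m + 1) =>
            (Dat.ofList (List.ofFn (foldCommitments m (reply r)))).nth i) =
            foldCommitments m (reply r) := by
          funext i
          rw [Dat.nth_ofList, List.getD_eq_getElem _ _ (by simpa using i.2)]
          exact List.getElem_ofFn _
        have h1 : ∀ a b c e : Dat, (Dat.ofList [a, b, c, e]).nth 1 = b := fun _ _ _ _ => rfl
        have h2 : ∀ a b c e : Dat, (Dat.ofList [a, b, c, e]).nth 2 = c := fun _ _ _ _ => rfl
        have h3 : ∀ a b c e : Dat, (Dat.ofList [a, b, c, e]).nth 3 = e := fun _ _ _ _ => rfl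
        have h0 : ∀ a b c e : Dat, (Dat.ofList [a, b, c, e]).hd = a := fun _ _ _ _ => rfl
        simp only [h1, h2, h3, h0, decodeVec_codeVec, hl]
        have hex : ∃ i, foldValues X G i ≠ y i := Function.ne_iff.1 hy.symm
        rw [← expec_and, ← apply_true_eq_expec]
        simp only [hex, true_and]
        exact le_rfl

end

/-! ### Resampling of random points -/

section Resampling

variable {F : Type*} {k : ℕ}

/-- The point with the coordinates of `X` before `s` and those of `Y` from `s` on. -/
def splice (s : ℕ) (X Y : Fin k → F) : Fin k → F := fun i => if i.val < s then X i else Y i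

theorem splice_splice_right {s s' : ℕ} (h : s ≤ s') (X W Y : Fin k → F) :
    splice s X (splice s' W Y) = splice s' (splice s X W) Y := by
  funext i
  unfold splice
  split_ifs <;> first | rfl | omega

theorem splice_splice_left (s : ℕ) (X W Y : Fin k → F) :
    splice s (splice s X W) Y = splice s X Y := by
  funext i
  unfold splice
  split_ifs <;> rfl

theorem splice_zero (X Y : Fin k → F) : splice 0 X Y = Y := by
  funext i
  simp [splice]

theorem splice_eq_left {s : ℕ} (hs : k ≤ s) (X Y : Fin k → F) : splice s X Y = X := by
  funext i
  exact if_pos (i.2.trans_le hs)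

variable [Fintype F] [Nonempty F]

theorem expec_uniform_prod {α : Type*} [Fintype α] [Nonempty α] (ψ : α → α → ℝ≥0∞) :
    (expec (PMF.uniformOfFintype α) fun a => expec (PMF.uniformOfFintype α) (ψ a)) =
      (Fintype.card α : ℝ≥0∞)⁻¹ * ((Fintype.card α : ℝ≥0∞)⁻¹ * ∑ p : α × α, ψ p.1 p.2) := by
  simp only [expec_uniform, ← Finset.mul_sum, Fintype.sum_prod_type]

/-- Exchanging the tails of two independent uniform points is an involution on pairs, so it
preserves the uniform distribution. -/
theorem expec_uniform_splice (s : ℕ) (φ : (Fin k → F) → ℝ≥0∞) :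
    expec (PMF.uniformOfFintype (Fin k → F)) φ =
      expec (PMF.uniformOfFintype _) fun W => expec (PMF.uniformOfFintype _) fun Y =>
        φ (splice s W Y) := by
  let e : ((Fin k → F) × (Fin k → F)) ≃ ((Fin k → F) × (Fin k → F)) :=
    Function.Involutive.toPerm (fun p => (splice s p.1 p.2, splice s p.2 p.1)) (by
      rintro ⟨W, Y⟩
      ext i <;> simp only [splice] <;> split_ifs <;> rfl)
  have h := e.sum_comp fun p => φ p.1
  rw [expec_uniform_prod]
  change _ = _ * (_ * ∑ p, φ (e p).1)
  rw [h, ← expec_uniform_prod fun W _ => φ W]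
  simp only [expec_const]

/-- Sampling a point in two stages. -/
theorem expec_uniform_stages {s s' : ℕ} (h : s ≤ s') (X : Fin k → F) (φ : (Fin k → F) → ℝ≥0∞) :
    (expec (PMF.uniformOfFintype (Fin k → F)) fun Y => φ (splice s X Y)) =
      expec (PMF.uniformOfFintype _) fun W => expec (PMF.uniformOfFintype _) fun Y =>
        φ (splice s' (splice s X W) Y) := by
  rw [expec_uniform_splice s']
  simp only [splice_splice_right h]

end Resampling

/-! ### Polynomial functions and the Schwartz–Zippel lemma -/

section PolyFun

variable {F : Type*} [Field F] {k D : ℕ}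

/-- Functions given by polynomials of total degree at most `D`. -/
def IsPolyFun (D : ℕ) (φ : (Fin k → F) → F) : Prop :=
  ∃ p : MvPolynomial (Fin k) F, p.totalDegree ≤ D ∧ ∀ X, MvPolynomial.eval X p = φ X

theorem IsPolyFun.add {φ ψ : (Fin k → F) → F} (hφ : IsPolyFun D φ) (hψ : IsPolyFun D ψ) :
    IsPolyFun D fun X => φ X + ψ X := by
  obtain ⟨p, hp, hp'⟩ := hφ
  obtain ⟨q, hq, hq'⟩ := hψ
  exact ⟨p + q, (MvPolynomial.totalDegree_add p q).trans (max_le hp hq), by simp [hp', hq']⟩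

theorem IsPolyFun.const_mul {φ : (Fin k → F) → F} (c : F) (hφ : IsPolyFun D φ) :
    IsPolyFun D fun X => c * φ X := by
  obtain ⟨p, hp, hp'⟩ := hφ
  refine ⟨MvPolynomial.C c * p, (MvPolynomial.totalDegree_mul _ _).trans ?_, by simp [hp']⟩
  simpa using hp

theorem IsPolyFun.sub {φ ψ : (Fin k → F) → F} (hφ : IsPolyFun D φ) (hψ : IsPolyFun D ψ) :
    IsPolyFun D fun X => φ X - ψ X := by
  have := hφ.add (hψ.const_mul (-1))
  simpa only [neg_mul, one_mul, ← sub_eq_add_neg] using this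

theorem IsPolyFun.sum {ι : Type*} (s : Finset ι) {φ : ι → (Fin k → F) → F}
    (h : ∀ i ∈ s, IsPolyFun D (φ i)) : IsPolyFun D fun X => ∑ i ∈ s, φ i X := by
  classical
  induction s using Finset.induction_on with
  | empty => exact ⟨0, by simp, by simp⟩
  | insert i s hi ih =>
    simp only [Finset.sum_insert hi]
    exact (h i (by simp)).add (ih fun j hj => h j (by simp [hj]))

/-- Substitution of coordinates and constants. -/
theorem IsPolyFun.subst {φ : (Fin k → F) → F} (hφ : IsPolyFun D φ)
    {σ : (Fin k → F) → Fin k → F}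
    (hσ : ∀ i, (∃ j, ∀ X, σ X i = X j) ∨ ∃ c, ∀ X, σ X i = c) :
    IsPolyFun D fun X => φ (σ X) := by
  obtain ⟨p, hp, hp'⟩ := hφ
  have hq : ∀ i, ∃ q : MvPolynomial (Fin k) F, q.totalDegree ≤ 1 ∧
      ∀ X, MvPolynomial.eval X q = σ X i := by
    intro i
    rcases hσ i with ⟨j, hj⟩ | ⟨c, hc⟩
    · exact ⟨MvPolynomial.X j, by simp, by simp [hj]⟩
    · exact ⟨MvPolynomial.C c, by simp, by simp [hc]⟩
  choose q hq hq' using hq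
  -- Substitution monomial by monomial: each variable becomes a polynomial of degree at most 1, so
  -- no degree grows.
  refine ⟨∑ e ∈ p.support, MvPolynomial.C (p.coeff e) * ∏ i, q i ^ e i, ?_, fun X => ?_⟩
  · refine MvPolynomial.totalDegree_finsetSum_le fun e he => ?_
    refine (MvPolynomial.totalDegree_mul _ _).trans ?_
    rw [MvPolynomial.totalDegree_C, zero_add]
    have he' := (MvPolynomial.le_totalDegree he).trans hp
    rw [Finsupp.sum_fintype _ _ fun _ => rfl] at he'
    exact (MvPolynomial.totalDegree_finsetProd _ _).trans ((Finset.sum_le_sum fun i _ =>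
      (MvPolynomial.totalDegree_pow _ _).trans (mul_le_of_le_one_right' (hq i))).trans he')
  · simp only [← hp', map_sum, map_mul, map_prod, map_pow, MvPolynomial.eval_C, hq']
    rw [MvPolynomial.eval_eq']

/-- The Schwartz–Zippel lemma for polynomial functions. -/
theorem IsPolyFun.expec_zero_le [Fintype F] [DecidableEq F] {φ : (Fin k → F) → F}
    (hφ : IsPolyFun D φ) {Y : Fin k → F} (hY : φ Y ≠ 0) :
    (expec (PMF.uniformOfFintype (Fin k → F)) fun X => if φ X = 0 then 1 else 0) ≤
      (D : ℝ≥0∞) / Fintype.card F := by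
  obtain ⟨p, hp, hp'⟩ := hφ
  have hp0 : p ≠ 0 := by
    rintro rfl
    exact hY (by simp [← hp'])
  have h := MvPolynomial.schwartz_zippel_totalDegree hp0 (Finset.univ : Finset F)
  have hq : (0 : ℚ≥0) < Fintype.card F := by exact_mod_cast Fintype.card_pos
  rw [Fintype.piFinset_univ, Finset.card_univ, div_le_div_iff₀ (by positivity) hq] at h
  have h' : (Finset.univ.filter fun X => φ X = 0).card * Fintype.card F ≤
      D * Fintype.card F ^ k := by
    have : (Finset.univ.filter fun X => MvPolynomial.eval X p = 0).card * Fintype.card F ≤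
        p.totalDegree * Fintype.card F ^ k := by exact_mod_cast h
    simp only [hp'] at this
    exact this.trans (Nat.mul_le_mul_right _ hp)
  rw [expec_uniform, Finset.sum_boole, ENNReal.le_div_iff_mul_le (by simp) (by simp), mul_assoc,
    mul_comm, ← div_eq_mul_inv, ENNReal.div_le_iff (by simp) (by simp), Fintype.card_fun,
    Fintype.card_fin]
  exact_mod_cast h'

end PolyFun

/-! ### Sums over the coordinates that are not fixed yet -/

section Sums

variable {F : Type*} [Field F] {k : ℕ} (H : Finset F)

/-- The points of the cube over `H` in the coordinates of an interval, `0` elsewhere. -/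
def cube (H : Finset F) (k s s' : ℕ) : Finset (Fin k → F) :=
  Fintype.piFinset fun i : Fin k => if s ≤ i.val ∧ i.val < s' then H else {0}

theorem mem_cube {s s' : ℕ} {x : Fin k → F} : x ∈ cube H k s s' ↔
    ∀ i : Fin k, (s ≤ i.val ∧ i.val < s' → x i ∈ H) ∧ (¬ (s ≤ i.val ∧ i.val < s') → x i = 0) := by
  rw [cube, Fintype.mem_piFinset]
  refine forall_congr' fun i => ?_
  split_ifs with h <;> simp [h]

/-- The sum over all values in `H` of the coordinates from `s` on. -/
def tailSum (s : ℕ) (φ : (Fin k → F) → F) (X : Fin k → F) : F :=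
  ∑ y ∈ cube H k s k, φ (splice s X y)

/-- The sum over the coordinates from `s` on, in two stages. -/
theorem sum_cube_tailSum {s s' : ℕ} (h : s ≤ s') (φ : (Fin k → F) → F) (X : Fin k → F) :
    ∑ x ∈ cube H k s s', tailSum H s' φ (splice s X x) = tailSum H s φ X := by
  simp only [tailSum]
  rw [← Finset.sum_product']
  -- Points of a cube vanish outside their interval, so cutting at `s'` and filling up with zeros
  -- inverts the splicing.
  refine Finset.sum_nbij' (fun p => splice s' p.1 p.2)
    (fun y => (splice s' y 0, splice s' 0 y)) ?_ ?_ ?_ ?_ ?_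
  · rintro ⟨x, y⟩ hxy
    rw [Finset.mem_product, mem_cube, mem_cube] at hxy
    rw [mem_cube]
    intro i
    have h1 := hxy.1 i
    have h2 := hxy.2 i
    have h3 := i.2
    dsimp only at h1 h2
    unfold splice
    split_ifs with hi
    · exact ⟨fun h => h1.1 (by omega), fun h => h1.2 (by omega)⟩
    · exact ⟨fun h => h2.1 (by omega), fun h => h2.2 (by omega)⟩
  · intro y hy
    rw [mem_cube] at hy
    rw [Finset.mem_product, mem_cube, mem_cube]
    refine ⟨fun i => ?_, fun i => ?_⟩ <;> have h1 := hy i <;> have h3 := i.2 <;> dsimp only <;>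
      unfold splice <;> split_ifs with hi
    · exact ⟨fun h => h1.1 (by omega), fun h => h1.2 (by omega)⟩
    · exact ⟨fun h => by omega, fun h => rfl⟩
    · exact ⟨fun h => by omega, fun h => rfl⟩
    · exact ⟨fun h => h1.1 (by omega), fun h => h1.2 (by omega)⟩
  · rintro ⟨x, y⟩ hxy
    rw [Finset.mem_product, mem_cube, mem_cube] at hxy
    refine Prod.ext (funext fun i => ?_) (funext fun i => ?_)
    · have h1 := (hxy.1 i).2
      dsimp only at h1 ⊢
      unfold splice
      split_ifs with hi
      · rfl
      · exact (h1 (by omega)).symm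
    · have h1 := (hxy.2 i).2
      dsimp only at h1 ⊢
      unfold splice
      split_ifs with hi
      · exact (h1 (by omega)).symm
      · rfl
  · intro y hy
    funext i
    simp only [splice]
    split_ifs <;> rfl
  · rintro ⟨x, y⟩ -
    dsimp only
    rw [splice_splice_right h]

theorem window_point {start len : ℕ} (hk : start + len ≤ k) (Y : Fin k → F) (i : Fin k) :
    (window k start len).point Y i =
      if h : i.val < len then Y ⟨start + i.val, by omega⟩ else 0 := by
  unfold Placement.point window
  by_cases h : i.val < len
  · have h2 : start + i.val < k := by omega
    simp [h, h2]
  · simp [h]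

theorem window_point_congr {start len : ℕ} (hk : start + len ≤ k) {X Y : Fin k → F}
    (h : ∀ i : Fin k, start ≤ i.val → i.val < start + len → X i = Y i) :
    (window k start len).point X = (window k start len).point Y := by
  funext i
  rw [window_point hk, window_point hk]
  split_ifs with hi
  · exact h _ (by simp) (by simpa using hi)
  · rfl

/-- The sum over a window does not depend on its position. -/
theorem sum_cube_window {start len : ℕ} (hk : start + len ≤ k) (φ : (Fin k → F) → F) :
    ∑ y ∈ cube H k start (start + len), φ ((window k start len).point y) =
      ∑ x ∈ cube H k 0 len, φ x := by
  refine Finset.sum_nbij' (fun y => (window k start len).point y)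
    (fun x i => if h : start ≤ i.val ∧ i.val < start + len then x ⟨i.val - start, by omega⟩ else 0)
    ?_ ?_ ?_ ?_ ?_
  · intro y hy
    rw [mem_cube] at hy
    rw [mem_cube]
    intro i
    rw [window_point hk]
    split_ifs with hi
    · exact ⟨fun _ => (hy _).1 (by simpa using hi), fun h => by omega⟩
    · exact ⟨fun h => by omega, fun _ => rfl⟩
  · intro x hx
    rw [mem_cube] at hx
    rw [mem_cube]
    intro i
    split_ifs with hi
    · exact ⟨fun _ => (hx _).1 (by dsimp only; omega), fun h => absurd hi h⟩
    · exact ⟨fun h => absurd h hi, fun _ => rfl⟩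
  · intro y hy
    rw [mem_cube] at hy
    funext i
    split_ifs with hi
    · rw [window_point hk, dif_pos (by dsimp only; omega)]
      congr 1
      ext
      dsimp only
      omega
    · exact ((hy i).2 hi).symm
  · intro x hx
    rw [mem_cube] at hx
    funext i
    rw [window_point hk]
    by_cases hi : i.val < len
    · rw [dif_pos hi, dif_pos (by dsimp only; omega)]
      congr 1
      ext
      simp
    · rw [dif_neg hi]
      exact ((hx i).2 (by omega)).symm
  · intro y _
    rfl

theorem sum_cube_one {k : ℕ} (hk : 0 < k) (φ : (Fin k → F) → F) :
    ∑ x ∈ cube H k 0 1, φ x = ∑ a ∈ H, φ fun i => if i.val = 0 then a else 0 := by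
  refine Finset.sum_nbij' (fun x => x ⟨0, hk⟩) (fun a i => if i.val = 0 then a else 0)
    ?_ ?_ ?_ ?_ ?_
  · intro x hx
    rw [mem_cube] at hx
    exact (hx ⟨0, hk⟩).1 (by simp)
  · intro a ha
    rw [mem_cube]
    intro i
    split_ifs with hi
    · exact ⟨fun _ => ha, fun h => by omega⟩
    · exact ⟨fun h => by omega, fun _ => rfl⟩
  · intro x hx
    rw [mem_cube] at hx
    funext i
    split_ifs with hi
    · congr 1
      ext
      exact hi.symm
    · exact ((hx i).2 (by omega)).symm
  · intro a _
    simp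
  · intro x hx
    rw [mem_cube] at hx
    congr 1
    funext i
    split_ifs with hi
    · congr 1
      ext
      exact hi
    · exact (hx i).2 (by omega)

theorem isPolyFun_eval {k d D : ℕ} (g : BPoly F k d D) :
    IsPolyFun D fun Y => MvPolynomial.eval Y g.1 :=
  ⟨g.1, g.2.2, fun _ => rfl⟩

theorem IsPolyFun.window {D : ℕ} {φ : (Fin k → F) → F} (hφ : IsPolyFun D φ) {start len : ℕ}
    (hk : start + len ≤ k) : IsPolyFun D fun Y => φ ((window k start len).point Y) := by
  refine hφ.subst fun i => ?_
  simp only [window_point hk]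
  by_cases h : i.val < len
  · exact Or.inl ⟨⟨start + i.val, by omega⟩, by simp [h]⟩
  · exact Or.inr ⟨0, by simp [h]⟩

theorem IsPolyFun.splice {D : ℕ} {φ : (Fin k → F) → F} (hφ : IsPolyFun D φ) (s : ℕ)
    (X : Fin k → F) : IsPolyFun D fun W => φ (splice s X W) := by
  refine hφ.subst fun i => ?_
  by_cases h : i.val < s
  · exact Or.inr ⟨X i, fun _ => if_pos h⟩
  · exact Or.inl ⟨i, fun _ => if_neg h⟩

theorem IsPolyFun.tailSum {D : ℕ} {φ : (Fin k → F) → F} (hφ : IsPolyFun D φ) (s : ℕ) :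
    IsPolyFun D fun W => tailSum H s φ W := by
  refine IsPolyFun.sum _ fun y _ => hφ.subst fun i => ?_
  by_cases h : i.val < s
  · exact Or.inl ⟨i, fun _ => if_pos h⟩
  · exact Or.inr ⟨y i, fun _ => if_neg h⟩

end Sums

/-! ### The claims of Fold-DCS -/

/-- The first coordinate of the block of round `j`. -/
def foldStart (m j : ℕ) : ℕ := 2 ^ m - 2 ^ (m - j)

theorem foldStart_zero (m : ℕ) : foldStart m 0 = 0 := by simp [foldStart]

theorem foldStart_self (m : ℕ) : foldStart m m = 2 ^ m - 1 := by simp [foldStart]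

theorem foldStart_mono (m : ℕ) : Monotone (foldStart m) := fun _ _ h =>
  Nat.sub_le_sub_left (Nat.pow_le_pow_right two_pos (Nat.sub_le_sub_left h m)) _

theorem two_pow_sub_succ {m j : ℕ} (hj : j < m) : 2 ^ (m - j) = 2 * 2 ^ (m - 1 - j) := by
  rw [← pow_succ']
  congr 1
  omega

theorem foldStart_add {m j : ℕ} (hj : j < m) :
    foldStart m j + 2 ^ (m - 1 - j) = foldStart m (j + 1) := by
  have h1 := two_pow_sub_succ hj
  have h2 : 2 ^ (m - j) ≤ 2 ^ m := Nat.pow_le_pow_right two_pos (by omega)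
  have h3 : m - (j + 1) = m - 1 - j := by omega
  rw [foldStart, foldStart, h3]
  omega

/-- After the block of round `j` exactly as many coordinates remain as the block has. This is why
one polynomial can be read both on the block and on the remainder. -/
theorem foldStart_succ_add {m j : ℕ} (hj : j < m) :
    foldStart m (j + 1) + 2 ^ (m - 1 - j) = 2 ^ m := by
  have h2 : 2 ^ (m - 1 - j) ≤ 2 ^ m := Nat.pow_le_pow_right two_pos (by omega)
  have h3 : m - (j + 1) = m - 1 - j := by omega
  rw [foldStart, h3]
  omega

theorem foldStart_le (m j : ℕ) : foldStart m j ≤ 2 ^ m := Nat.sub_le _ _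

theorem tailWindow_eq {m j : ℕ} (hj : j < m) :
    tailWindow m j = window (2 ^ m) (foldStart m (j + 1)) (2 ^ (m - 1 - j)) := by
  have h3 : m - (j + 1) = m - 1 - j := by omega
  rw [tailWindow, foldStart, h3]

theorem blockWindow_eq (m j : ℕ) :
    blockWindow m j = window (2 ^ m) (foldStart m j) (2 ^ (m - 1 - j)) := rfl

section

variable {F : Type*} [Field F]

theorem block_point_splice_left {m j s : ℕ} (hj : j < m) (hs : foldStart m (j + 1) ≤ s)
    (X Y : Fin (2 ^ m) → F) :
    (blockWindow m j).point (splice s X Y) = (blockWindow m j).point X := by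
  have h1 := foldStart_add hj
  have h2 := foldStart_le m (j + 1)
  refine window_point_congr (h1.trans_le h2) fun i _ hi => if_pos ?_
  exact (hi.trans_eq h1).trans_le hs

theorem block_point_splice_right {m j : ℕ} (hj : j < m) (X Y : Fin (2 ^ m) → F) :
    (blockWindow m j).point (splice (foldStart m j) X Y) = (blockWindow m j).point Y :=
  window_point_congr ((foldStart_add hj).trans_le (foldStart_le m (j + 1))) fun _ hi _ =>
    if_neg (not_lt.2 hi)

theorem tail_point_splice {m j : ℕ} (hj : j < m) (X Y : Fin (2 ^ m) → F) :
    (tailWindow m j).point (splice (foldStart m (j + 1)) X Y) = (tailWindow m j).point Y := by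
  rw [tailWindow_eq hj]
  exact window_point_congr (foldStart_succ_add hj).le fun _ hi _ => if_neg (not_lt.2 hi)

/-- The scalars, with value `0` outside their range. -/
def extendScalars {m : ℕ} (z : Fin m → F) (j : ℕ) : F := if h : j < m then z ⟨j, h⟩ else 0

theorem extendScalars_of_lt {m j : ℕ} (z : Fin m → F) (h : j < m) :
    extendScalars z j = z ⟨j, h⟩ := dif_pos h

theorem extendScalars_splice_left {m l j : ℕ} (h : l < j) (z u : Fin m → F) :
    extendScalars (splice j z u) l = extendScalars z l := by
  unfold extendScalars
  split_ifs
  · exact if_pos h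
  · rfl

theorem extendScalars_splice_right {m j : ℕ} (z u : Fin m → F) :
    extendScalars (splice j z u) j = extendScalars u j := by
  unfold extendScalars
  split_ifs
  · exact if_neg (lt_irrefl j)
  · rfl

variable {m d D : ℕ} (H : Finset F) (f : BPoly F (2 ^ m) d D) (S : F)

/-- The folded polynomial before round `j`, as a function of all coordinates. -/
noncomputable def foldPoly (z : Fin m → F) (G : ℕ → BPoly F (2 ^ m) d D) (j : ℕ)
    (Y : Fin (2 ^ m) → F) : F :=
  MvPolynomial.eval Y f.1 + ∑ l ∈ Finset.range j,
    extendScalars z l * MvPolynomial.eval ((tailWindow m l).point Y) (G l).1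

/-- The claimed sum of the folded polynomial before round `j`. -/
noncomputable def foldClaim (X : Fin (2 ^ m) → F) (z : Fin m → F)
    (G : ℕ → BPoly F (2 ^ m) d D) : ℕ → F
  | 0 => S
  | j + 1 => extendScalars z j * foldClaim X z G j +
      MvPolynomial.eval ((blockWindow m j).point X) (G j).1

/-- The claim before round `j` is true. -/
def FoldTrue (X : Fin (2 ^ m) → F) (z : Fin m → F) (G : ℕ → BPoly F (2 ^ m) d D) (j : ℕ) : Prop :=
  tailSum H (foldStart m j) (foldPoly f z G j) X = foldClaim S X z G j

theorem foldPoly_congr {z z' : Fin m → F} {G G' : ℕ → BPoly F (2 ^ m) d D} {j : ℕ}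
    (hz : ∀ l < j, extendScalars z l = extendScalars z' l) (hG : ∀ l < j, G l = G' l) :
    foldPoly f z G j = foldPoly f z' G' j := by
  funext Y
  unfold foldPoly
  congr 1
  refine Finset.sum_congr rfl fun l hl => ?_
  rw [hz l (Finset.mem_range.1 hl), hG l (Finset.mem_range.1 hl)]

theorem foldClaim_congr {X X' : Fin (2 ^ m) → F} {z z' : Fin m → F}
    {G G' : ℕ → BPoly F (2 ^ m) d D} : ∀ {j : ℕ},
    (∀ l < j, (blockWindow m l).point X = (blockWindow m l).point X') →
    (∀ l < j, extendScalars z l = extendScalars z' l) → (∀ l < j, G l = G' l) →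
    foldClaim S X z G j = foldClaim S X' z' G' j
  | 0, _, _, _ => rfl
  | j + 1, hX, hz, hG => by
    rw [foldClaim, foldClaim, hX j j.lt_succ_self, hz j j.lt_succ_self, hG j j.lt_succ_self,
      foldClaim_congr (fun l hl => hX l (by omega)) (fun l hl => hz l (by omega))
        fun l hl => hG l (by omega)]

/-- The claim before round `j` involves only the polynomials of earlier rounds, so a further reply
does not affect it. -/
theorem foldTrue_congr {X : Fin (2 ^ m) → F} {z : Fin m → F}
    {G G' : ℕ → BPoly F (2 ^ m) d D} {j : ℕ} (hG : ∀ l < j, G l = G' l) :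
    FoldTrue H f S X z G j ↔ FoldTrue H f S X z G' j := by
  unfold FoldTrue
  rw [foldPoly_congr f (fun _ _ => rfl) hG,
    foldClaim_congr S (fun _ _ => rfl) (fun _ _ => rfl) hG]

theorem isPolyFun_foldPoly (z : Fin m → F) (G : ℕ → BPoly F (2 ^ m) d D) {j : ℕ} (hj : j ≤ m) :
    IsPolyFun D (foldPoly f z G j) := by
  refine (isPolyFun_eval f).add (IsPolyFun.sum _ fun l hl => IsPolyFun.const_mul _ ?_)
  have hl' : l < m := (Finset.mem_range.1 hl).trans_le hj
  rw [tailWindow_eq hl']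
  exact (isPolyFun_eval (G l)).window (foldStart_succ_add hl').le

/-- The sum over the cube of the polynomial sent in round `j`. -/
noncomputable def sentSum (g : BPoly F (2 ^ m) d D) (j : ℕ) : F :=
  ∑ x ∈ cube H (2 ^ m) 0 (2 ^ (m - 1 - j)), MvPolynomial.eval x g.1

/-- A sum over a window ignores its position. Hence the sum over the block and, in `tailSum_tail`,
the sum over the remainder are the same number. -/
theorem sum_cube_block (g : BPoly F (2 ^ m) d D) {j : ℕ} (hj : j < m) :
    ∑ x ∈ cube H (2 ^ m) (foldStart m j) (foldStart m (j + 1)),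
      MvPolynomial.eval ((blockWindow m j).point x) g.1 = sentSum H g j := by
  rw [← foldStart_add hj, blockWindow_eq]
  exact sum_cube_window H ((foldStart_add hj).trans_le (foldStart_le m (j + 1)))
    fun x => MvPolynomial.eval x g.1

theorem tailSum_tail (g : BPoly F (2 ^ m) d D) {j : ℕ} (hj : j < m) (X : Fin (2 ^ m) → F) :
    tailSum H (foldStart m (j + 1)) (fun Y => MvPolynomial.eval ((tailWindow m j).point Y) g.1) X =
      sentSum H g j := by
  unfold tailSum
  simp only [tail_point_splice hj]
  have h := sum_cube_window H (foldStart_succ_add hj).le fun x => MvPolynomial.eval x g.1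
  rw [foldStart_succ_add hj] at h
  rw [tailWindow_eq hj]
  exact h

/-- The new claim is affine in the new scalar, with coefficient `sentSum` on the left and the old
claim on the right; the other two terms depend only on the coins through the block. -/
theorem foldTrue_succ_iff {X W : Fin (2 ^ m) → F} {z u : Fin m → F}
    {G : ℕ → BPoly F (2 ^ m) d D} {j : ℕ} (hj : j < m) :
    FoldTrue H f S (splice (foldStart m j) X W) (splice j z u) G (j + 1) ↔
      tailSum H (foldStart m (j + 1)) (foldPoly f z G j) (splice (foldStart m j) X W) +
          u ⟨j, hj⟩ * sentSum H (G j) j =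
        u ⟨j, hj⟩ * foldClaim S X z G j +
          MvPolynomial.eval ((blockWindow m j).point W) (G j).1 := by
  have hz : ∀ l < j, extendScalars (splice j z u) l = extendScalars z l := fun l hl =>
    extendScalars_splice_left hl z u
  have h1 : foldPoly f (splice j z u) G (j + 1) = fun Y => foldPoly f z G j Y +
      u ⟨j, hj⟩ * MvPolynomial.eval ((tailWindow m j).point Y) (G j).1 := by
    funext Y
    rw [← foldPoly_congr f hz fun l _ => rfl, foldPoly, foldPoly, Finset.sum_range_succ,
      extendScalars_splice_right, extendScalars_of_lt u hj, add_assoc]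
  have h2 : tailSum H (foldStart m (j + 1)) (foldPoly f (splice j z u) G (j + 1))
      (splice (foldStart m j) X W) =
      tailSum H (foldStart m (j + 1)) (foldPoly f z G j) (splice (foldStart m j) X W) +
          u ⟨j, hj⟩ * sentSum H (G j) j := by
    rw [h1, ← tailSum_tail H (G j) hj (splice (foldStart m j) X W)]
    simp only [tailSum, Finset.sum_add_distrib, Finset.mul_sum]
  rw [FoldTrue, h2, foldClaim, extendScalars_splice_right, extendScalars_of_lt u hj,
    block_point_splice_right hj, foldClaim_congr S (fun l hl =>
    block_point_splice_left (by omega) (foldStart_mono m (by omega)) X W) hz fun l _ => rfl]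

variable [Fintype F]

open Classical in
/-- A false claim becomes true in one round with probability at most `D / |F|`. -/
theorem expec_foldTrue_succ_le (hD : 1 ≤ D) {X : Fin (2 ^ m) → F} {z : Fin m → F}
    {G : ℕ → BPoly F (2 ^ m) d D} {j : ℕ} (hj : j < m) (hfalse : ¬ FoldTrue H f S X z G j) :
    (expec (PMF.uniformOfFintype (Fin (2 ^ m) → F)) fun W =>
      expec (PMF.uniformOfFintype (Fin m → F)) fun u =>
        if FoldTrue H f S (splice (foldStart m j) X W) (splice j z u) G (j + 1) then 1 else 0) ≤
      (D : ℝ≥0∞) / Fintype.card F := by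
  simp only [foldTrue_succ_iff H f S hj]
  set A := fun W => tailSum H (foldStart m (j + 1)) (foldPoly f z G j)
    (splice (foldStart m j) X W) with hA
  set B := fun W => MvPolynomial.eval ((blockWindow m j).point W) (G j).1 with hB
  set c := foldClaim S X z G j with hc
  -- Both coefficients of the scalar are fixed before the coins of this round are drawn, so only one
  -- of the two sources of error occurs, and the bound is their maximum.
  by_cases hcT : c = sentSum H (G j) j
  · have hpoly : IsPolyFun D fun W => A W - B W := by
      refine IsPolyFun.sub ?_ ((isPolyFun_eval (G j)).window
        ((foldStart_add hj).trans_le (foldStart_le m (j + 1))))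
      exact ((isPolyFun_foldPoly f z G hj.le).tailSum H _).splice _ _
    -- This sum is the true sum minus the claim, so some point of the cube witnesses that the
    -- difference is not the zero function.
    have hne : ∑ x ∈ cube H (2 ^ m) (foldStart m j) (foldStart m (j + 1)), (A x - B x) ≠ 0 := by
      rw [Finset.sum_sub_distrib, sum_cube_block H (G j) hj, hA,
        sum_cube_tailSum H (foldStart_mono m (Nat.le_succ j)), sub_ne_zero, ← hcT]
      exact hfalse
    obtain ⟨Y, -, hY⟩ := Finset.exists_ne_zero_of_sum_ne_zero hne
    refine le_trans (expec_mono fun W => expec_le fun u => ?_) (hpoly.expec_zero_le hY)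
    refine le_of_eq (if_congr ?_ rfl rfl)
    rw [hcT, sub_eq_zero, add_comm, add_right_inj]
  · refine expec_le fun W => ?_
    -- For a given block a single scalar is bad. Schwartz–Zippel is applied to a linear polynomial,
    -- which has degree at most `D` because `1 ≤ D`.
    have hX : IsPolyFun D fun u : Fin m → F => u ⟨j, hj⟩ - (B W - A W) / (sentSum H (G j) j - c) :=
      ⟨MvPolynomial.X ⟨j, hj⟩ - MvPolynomial.C ((B W - A W) / (sentSum H (G j) j - c)),
        (MvPolynomial.totalDegree_sub_C_le _ _).trans (by simpa using hD), by simp⟩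
    refine le_trans (expec_mono fun u => ?_) (hX.expec_zero_le
      (Y := fun _ => (B W - A W) / (sentSum H (G j) j - c) + 1) (by simp))
    refine le_of_eq (if_congr ?_ rfl rfl)
    have h0 : sentSum H (G j) j - c ≠ 0 := sub_ne_zero.2 (Ne.symm hcT)
    rw [sub_eq_zero, eq_div_iff h0]
    constructor
    · intro h
      linear_combination h
    · intro h
      linear_combination h

end

/-! ### Soundness against provers that commit to polynomials and send true values -/

section

variable {F : Type*} [Field F] {m d D : ℕ}

theorem foldClaim_eq (S : F) (X : Fin (2 ^ m) → F) (z : Fin m → F)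
    (G : ℕ → BPoly F (2 ^ m) d D) : ∀ j, foldClaim S X z G j =
      (∏ l ∈ Finset.range j, extendScalars z l) * S + ∑ i ∈ Finset.range j,
        (∏ l ∈ Finset.Ico (i + 1) j, extendScalars z l) *
          MvPolynomial.eval ((blockWindow m i).point X) (G i).1
  | 0 => by simp [foldClaim]
  | j + 1 => by
    rw [foldClaim, foldClaim_eq S X z G j, Finset.prod_range_succ, Finset.sum_range_succ,
      Finset.Ico_self, Finset.prod_empty, one_mul, mul_add, Finset.mul_sum, ← add_assoc]
    congr 2
    · ring
    · refine Finset.sum_congr rfl fun i hi => ?_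
      rw [Finset.prod_Ico_succ_top (by have := Finset.mem_range.1 hi; omega)]
      ring

theorem eval_toUnivariate {k : ℕ} (g : BPoly F k d D) (a : F) :
    (toUnivariate g).eval a = MvPolynomial.eval (fun i => if i.val = 0 then a else 0) g.1 := by
  rw [toUnivariate, ← Polynomial.coe_evalRingHom, MvPolynomial.aeval_def,
    MvPolynomial.eval₂_comp_left, MvPolynomial.eval, MvPolynomial.coe_eval₂Hom]
  congr 1
  · ext
    simp
  · funext i
    simp only [Function.comp_apply]
    split_ifs <;> simp

/-- Only the variable 0 contributes to the degree of a monomial: the other variables become 0, whose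
powers are constants. -/
theorem natDegree_toUnivariate_le {k : ℕ} (hk : 0 < k) (g : BPoly F k d D) :
    (toUnivariate g).natDegree ≤ d := by
  rw [toUnivariate, MvPolynomial.aeval_def, MvPolynomial.eval₂_eq']
  refine Polynomial.natDegree_sum_le_of_forall_le _ _ fun e he => ?_
  refine (Polynomial.natDegree_C_mul_le _ _).trans ((Polynomial.natDegree_prod_le _ _).trans ?_)
  refine le_trans ?_ ((MvPolynomial.monomial_le_degreeOf ⟨0, hk⟩ he).trans (g.2.1 ⟨0, hk⟩))
  rw [Finset.sum_eq_single ⟨0, hk⟩]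
  · simp
  · intro i _ hi
    have : i.val ≠ 0 := fun h => hi (Fin.ext h)
    rw [if_neg this]
    rcases Nat.eq_zero_or_pos (e i) with h | h
    · simp [h]
    · simp [zero_pow h.ne']
  · simp

theorem foldSum_foldValues (S : F) (X : Fin (2 ^ m) → F) (z : Fin m → F)
    (G : ℕ → BPoly F (2 ^ m) d D) :
    foldSum m z S (foldValues X fun j : Fin (m + 1) => G j) = foldClaim S X z G m := by
  rw [foldClaim_eq, foldSum, Finset.prod_range, Finset.sum_range]
  congr 1
  · congr 1
    exact Finset.prod_congr rfl fun l _ => (extendScalars_of_lt z l.2).symm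
  · refine Finset.sum_congr rfl fun j _ => ?_
    congr 1
    · refine Finset.prod_bij (fun l _ => l.val) ?_ ?_ ?_ ?_
      · intro l hl
        have := (Finset.mem_filter.1 hl).2
        rw [Finset.mem_Ico]
        exact ⟨this, l.2⟩
      · intro a _ b _ h
        exact Fin.ext h
      · intro l hl
        rw [Finset.mem_Ico] at hl
        exact ⟨⟨l, hl.2⟩, Finset.mem_filter.2 ⟨Finset.mem_univ _, hl.1⟩, rfl⟩
      · intro l _
        exact (extendScalars_of_lt z l.2).symm
    · simp [foldValues, foldPlacement, foldIndex]

/-- For true values the check says that the final polynomial agrees with the folded one at β, which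
is where Schwartz–Zippel in β applies. -/
theorem foldConsistent_foldValues (f : BPoly F (2 ^ m) d D) (X : Fin (2 ^ m) → F) (z : Fin m → F)
    (G : ℕ → BPoly F (2 ^ m) d D) :
    foldConsistent m z (MvPolynomial.eval X f.1) (foldValues X fun j : Fin (m + 1) => G j) ↔
      MvPolynomial.eval ((window (2 ^ m) (2 ^ m - 1) 1).point X) (G m).1 = foldPoly f z G m X := by
  rw [foldConsistent, foldPoly, Finset.sum_range]
  refine Eq.congr ?_ ?_
  · simp only [foldValues, foldPlacement, foldIndex]
    rw [if_neg (by omega), if_neg (by omega)]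
    congr 3
    rw [if_neg (by omega), if_neg (by omega)]
  · congr 1
    refine Finset.sum_congr rfl fun j _ => ?_
    have h1 : ¬ m + j.val < m := by omega
    have h2 : m + j.val < 2 * m := by omega
    simp [foldValues, foldPlacement, foldIndex, extendScalars_of_lt z j.2, h2]

variable (H : Finset F) (f : BPoly F (2 ^ m) d D) (S : F) (p : ℝ≥0∞)

open Classical in
/-- A bound for the probability of acceptance once the prover has committed to the polynomials
`G`, if he sends their true values. -/
noncomputable def foldPayoff (X : Fin (2 ^ m) → F) (z : Fin m → F)
    (G : Fin (m + 1) → BPoly F (2 ^ m) d D) : ℝ≥0∞ :=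
  if foldConsistent m z (MvPolynomial.eval X f.1) (foldValues X G) then
    if ∑ a ∈ H, (toUnivariate (G (Fin.last m))).eval a = foldSum m z S (foldValues X G) then 1
    else p
  else 0

theorem foldPayoff_le_one (hp : p ≤ 1) (X : Fin (2 ^ m) → F) (z : Fin m → F)
    (G : Fin (m + 1) → BPoly F (2 ^ m) d D) : foldPayoff H f S p X z G ≤ 1 := by
  unfold foldPayoff
  split_ifs <;> simp [hp]

/-- The polynomials behind the replies of a prover. -/
def polysOf (Γ : Dat → BPoly F (2 ^ m) d D) (h : List Dat) (j : ℕ) : BPoly F (2 ^ m) d D :=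
  Γ (h.getD j Dat.nil)

theorem polysOf_append (Γ : Dat → BPoly F (2 ^ m) d D) (h l : List Dat) {j : ℕ}
    (hj : j < h.length) : polysOf Γ (h ++ l) j = polysOf Γ h j := by
  rw [polysOf, polysOf, List.getD_append _ _ _ _ hj]

variable [Fintype F]

/-- The last step of the protocol. -/
theorem expec_foldPayoff_le {X : Fin (2 ^ m) → F} {z : Fin m → F}
    {G : ℕ → BPoly F (2 ^ m) d D} (hfalse : ¬ FoldTrue H f S X z G m) :
    (expec (PMF.uniformOfFintype (Fin (2 ^ m) → F)) fun W =>
      foldPayoff H f S p (splice (foldStart m m) X W) z fun j => G j) ≤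
      max p ((D : ℝ≥0∞) / Fintype.card F) := by
  classical
  have hpos : 0 < 2 ^ m := Nat.two_pow_pos m
  have hk : 2 ^ m - 1 + 1 ≤ 2 ^ m := by omega
  have hclaim : ∀ W, foldClaim S (splice (foldStart m m) X W) z G m = foldClaim S X z G m :=
    fun W => foldClaim_congr S (fun l hl => block_point_splice_left (by omega)
      (foldStart_mono m (by omega)) X W) (fun _ _ => rfl) fun _ _ => rfl
  have hlast : ∀ W, (window (2 ^ m) (2 ^ m - 1) 1).point (splice (foldStart m m) X W) =
      (window (2 ^ m) (2 ^ m - 1) 1).point W := fun W =>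
    window_point_congr hk fun i hi _ => if_neg (by rw [foldStart_self]; omega)
  simp only [foldPayoff, foldSum_foldValues, foldConsistent_foldValues, hclaim, hlast,
    Fin.val_last]
  -- If the final polynomial has the claimed sum, it differs from the folded one, whose sum is
  -- different, and β must be a zero of the difference. Otherwise the univariate sumcheck is run on
  -- a false claim.
  by_cases hsum : ∑ a ∈ H, (toUnivariate (G m)).eval a = foldClaim S X z G m
  · refine le_trans ?_ (le_max_right _ _)
    have hpoly : IsPolyFun D fun W =>
        MvPolynomial.eval ((window (2 ^ m) (2 ^ m - 1) 1).point W) (G m).1 -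
          foldPoly f z G m (splice (foldStart m m) X W) :=
      ((isPolyFun_eval (G m)).window hk).sub ((isPolyFun_foldPoly f z G le_rfl).splice _ _)
    have hne : ∑ W ∈ cube H (2 ^ m) (foldStart m m) (2 ^ m),
        (MvPolynomial.eval ((window (2 ^ m) (2 ^ m - 1) 1).point W) (G m).1 -
          foldPoly f z G m (splice (foldStart m m) X W)) ≠ 0 := by
      have h1 : ∑ W ∈ cube H (2 ^ m) (foldStart m m) (2 ^ m),
          MvPolynomial.eval ((window (2 ^ m) (2 ^ m - 1) 1).point W) (G m).1 =
          foldClaim S X z G m := by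
        have h := sum_cube_window H hk fun x => MvPolynomial.eval x (G m).1
        rw [Nat.sub_add_cancel hpos, sum_cube_one H hpos, ← foldStart_self] at h
        rw [← hsum]
        simp only [eval_toUnivariate]
        rw [← h, foldStart_self]
      rw [Finset.sum_sub_distrib, h1, sub_ne_zero]
      exact Ne.symm hfalse
    obtain ⟨Y, -, hY⟩ := Finset.exists_ne_zero_of_sum_ne_zero hne
    refine le_trans (expec_mono fun W => le_of_eq ?_) (hpoly.expec_zero_le hY)
    rw [if_pos hsum]
    exact if_congr sub_eq_zero.symm rfl rfl
  · refine le_trans (expec_le fun W => ?_) (le_max_left _ _)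
    rw [if_neg hsum]
    split_ifs <;> simp

/-- Before reply `j` the verifier reveals only the block and the scalar of round `j - 1`, both of
which lie before the cut. -/
theorem foldMsg_splice {j : ℕ} (hj : j ≤ m) (X W : Fin (2 ^ m) → F) (z u : Fin m → F) :
    foldMsg m (splice (foldStart m j) X W) (splice j z u) j = foldMsg m X z j := by
  unfold foldMsg
  split_ifs with h0 h1
  · rfl
  · have e : j - 1 + 1 = j := by omega
    rw [block_point_splice_left h1 (by rw [e])]
    congr 2
    exact if_pos (by dsimp only; omega)
  · omega

/-- Reply `j` does not depend on the coins after the cut, so it may be drawn before them and then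
fixed. -/
theorem expec_talk_succ_le {j : ℕ} (hj : j ≤ m) (step : Dat → PMF Dat) (k : ℕ) (st : Dat)
    {h : List Dat} (hlen : h.length = j) (X : Fin (2 ^ m) → F) (z : Fin m → F)
    (φ : (Fin (2 ^ m) → F) → (Fin m → F) → Dat × List Dat → ℝ≥0∞) {c : ℝ≥0∞}
    (hc : ∀ o : Dat, (expec (PMF.uniformOfFintype (Fin (2 ^ m) → F)) fun Y =>
        expec (PMF.uniformOfFintype (Fin m → F)) fun v =>
          expec (talk step (fun h => foldMsg m (splice (foldStart m j) X Y) (splice j z v) h.length)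
            k o.hd (h ++ [o.tl])) (φ (splice (foldStart m j) X Y) (splice j z v))) ≤ c) :
    (expec (PMF.uniformOfFintype (Fin (2 ^ m) → F)) fun Y =>
        expec (PMF.uniformOfFintype (Fin m → F)) fun v =>
          expec (talk step (fun h => foldMsg m (splice (foldStart m j) X Y) (splice j z v) h.length)
            (k + 1) st h) (φ (splice (foldStart m j) X Y) (splice j z v))) ≤ c := by
  simp only [talk, expec_bind, hlen, foldMsg_splice hj]
  simp only [expec_comm (PMF.uniformOfFintype (Fin m → F)) (step _)]
  rw [expec_comm]
  exact expec_le hc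

/-- Soundness from round `m - n` on. -/
theorem expec_talk_foldPayoff_le (hD : 1 ≤ D) (hp : p ≤ 1) {b : ℕ → ℝ≥0∞}
    (hb : max p ((D : ℝ≥0∞) / Fintype.card F) ≤ b 0)
    (hb' : ∀ n, (D : ℝ≥0∞) / Fintype.card F * (1 - b n) + b n ≤ b (n + 1))
    (Γ : Dat → BPoly F (2 ^ m) d D) (step : Dat → PMF Dat) :
    ∀ (n j : ℕ), j + n = m → ∀ (st : Dat) (h : List Dat) (X : Fin (2 ^ m) → F) (z : Fin m → F),
      h.length = j → ¬ FoldTrue H f S X z (polysOf Γ h) j →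
      (expec (PMF.uniformOfFintype (Fin (2 ^ m) → F)) fun Y =>
        expec (PMF.uniformOfFintype (Fin m → F)) fun v =>
          expec (talk step (fun h => foldMsg m (splice (foldStart m j) X Y) (splice j z v) h.length)
            (n + 2) st h) fun r => foldPayoff H f S p (splice (foldStart m j) X Y) (splice j z v)
              fun i => polysOf Γ r.2 i) ≤ b n := by
  classical
  intro n
  induction n with
  | zero =>
    rintro j hj st h X z hlen hfalse
    obtain rfl : j = m := by omega
    refine expec_talk_succ_le le_rfl step 1 st hlen X z (fun X z r => foldPayoff H f S p X z
      fun i => polysOf Γ r.2 i) fun o => ?_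
    have hfalse' : ¬ FoldTrue H f S X z (polysOf Γ (h ++ [o.tl])) j := by
      rwa [foldTrue_congr H f S fun l hl => polysOf_append Γ h [o.tl] (hl.trans_eq hlen.symm)]
    refine le_trans (expec_mono fun Y => expec_le fun v => ?_)
      ((expec_foldPayoff_le H f S p hfalse').trans hb)
    -- All scalars are fixed by now, and the one remaining reply carries alleged values and no
    -- polynomial of the payoff.
    rw [splice_eq_left le_rfl]
    refine expec_le_of_support fun r hr => le_of_eq ?_
    obtain ⟨l, hl, -⟩ := exists_of_mem_support_talk hr
    congr 1
    funext i
    rw [hl, polysOf_append]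
    simp only [List.length_append, hlen, List.length_singleton]
    exact i.2
  | succ n ih =>
    rintro j hj st h X z hlen hfalse
    have hjm : j < m := by omega
    refine expec_talk_succ_le hjm.le step (n + 2) st hlen X z (fun X z r => foldPayoff H f S p X z
      fun i => polysOf Γ r.2 i) fun o => ?_
    have hfalse' : ¬ FoldTrue H f S X z (polysOf Γ (h ++ [o.tl])) j := by
      rwa [foldTrue_congr H f S fun l hl => polysOf_append Γ h [o.tl] (hl.trans_eq hlen.symm)]
    set Φ : (Fin (2 ^ m) → F) → (Fin m → F) → ℝ≥0∞ := fun X z =>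
      expec (talk step (fun h => foldMsg m X z h.length) (n + 2) o.hd (h ++ [o.tl])) fun r =>
        foldPayoff H f S p X z fun i => polysOf Γ r.2 i with hΦ
    change (expec _ fun Y => expec _ fun v => Φ (splice (foldStart m j) X Y) (splice j z v)) ≤ _
    have hΦ1 : ∀ X z, Φ X z ≤ 1 := fun X z => expec_le fun r => foldPayoff_le_one H f S p hp _ _ _
    -- The remaining coins are drawn in two stages: those of round `j`, then all later ones. The cut
    -- moves from `j` to `j + 1`.
    rw [expec_uniform_stages (foldStart_mono m (Nat.le_succ j)) X
      fun X => expec _ fun v => Φ X (splice j z v)]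
    simp only [expec_uniform_stages (Nat.le_succ j) z]
    simp only [expec_comm (PMF.uniformOfFintype (Fin (2 ^ m) → F))
      (PMF.uniformOfFintype (Fin m → F)) (fun Y u => expec _ fun v => Φ _ (splice _ (splice _ _ u) _))]
    refine le_trans ?_ (hb' n)
    -- If the claim has become true, the payoff is at most `1 ≤ (1 - b n) + b n`; if it is still
    -- false, the induction hypothesis gives `b n`.
    calc _ ≤ expec (PMF.uniformOfFintype (Fin (2 ^ m) → F)) fun W =>
          expec (PMF.uniformOfFintype (Fin m → F)) fun u =>
            (if FoldTrue H f S (splice (foldStart m j) X W) (splice j z u)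
              (polysOf Γ (h ++ [o.tl])) (j + 1) then 1 else 0) * (1 - b n) + b n := by
          refine expec_mono fun W => expec_mono fun u => ?_
          split_ifs with ht
          · rw [one_mul]
            exact (expec_le fun Y => expec_le fun v => hΦ1 _ _).trans le_tsub_add
          · rw [zero_mul, zero_add]
            exact ih (j + 1) (by omega) o.hd (h ++ [o.tl]) _ _ (by simp [hlen]) ht
      _ ≤ _ := by
          simp only [expec_add, expec_const, expec_mul_right]
          gcongr
          exact expec_foldTrue_succ_le H f S hD hjm hfalse'

end

/-! ### Soundness of Fold-DCS -/

theorem apply_true_le_ofReal {q : PMF Bool} {p : ℝ} (h : prob q ≤ p) :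
    q true ≤ ENNReal.ofReal p := by
  rw [← ENNReal.ofReal_toReal (PMF.apply_ne_top q true)]
  exact ENNReal.ofReal_le_ofReal h

section

variable {F : Type*} [Field F] [Fintype F] {m d D : ℕ} (pcs : PCS F (2 ^ m) d D)
  (US : USVerifier F) (P : PPT) (f : BPoly F (2 ^ m) d D) (S : F)

open Classical in
/-- The decision of the verifier after the conversation `r`. -/
noncomputable def foldVerdict (X : Fin (2 ^ m) → F) (z : Fin m → F) (sec : ℕ) (pp : Dat)
    (r : Dat × List Dat) : PMF Bool :=
  match decodeVec F (2 * m + 1) (reply r (m + 1)).hd,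
      decodePoly F (2 ^ m) d D (reply r (m + 1)).tl with
  | some y, some g =>
      ((pcs.evalV (foldPlacement m) sec pp (foldCommitments m (reply r)) X y).interact
        (P.run sec) r.1).bind fun e =>
      ((US (toUnivariate g) (foldSum m z S y)).interact (P.run sec) e.2).map fun u =>
      decide ((∀ j < m, pcs.IsCommitment pp (reply r j)) ∧ pcs.opens pp g (reply r m) = true ∧
        foldConsistent m z (MvPolynomial.eval X f.1) y ∧ e.1 = true ∧ u.1 = true)
  | _, _ => PMF.pure false

theorem foldDCS_eq (sec : ℕ) : foldDCS pcs US P sec f S =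
    (pcs.setup sec).bind fun pp => (PMF.uniformOfFintype (Fin (2 ^ m) → F)).bind fun X =>
      (PMF.uniformOfFintype (Fin m → F)).bind fun z =>
        (foldTalk P sec f S X z pp).bind (foldVerdict pcs US P f S X z sec pp) := rfl

open Classical in
/-- The expected number of bad events after the conversation `r`: pairs of openings of the last
commitment, and acceptance of false values by the evaluation protocol. -/
noncomputable def foldBad [Fintype (BPoly F (2 ^ m) d D)] (X : Fin (2 ^ m) → F) (sec : ℕ)
    (pp : Dat) (r : Dat × List Dat) : ℝ≥0∞ :=
  (∑ q : BPoly F (2 ^ m) d D × BPoly F (2 ^ m) d D, if q.1 ≠ q.2 then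
      (if reply r m = pcs.commit pp q.1 ∧ reply r m = pcs.commit pp q.2 then 1 else 0) else 0) +
    ∑ q : (Fin (m + 1) → BPoly F (2 ^ m) d D) × (Fin (2 * m + 1) → F),
      if q.2 ≠ foldValues X q.1 then
        (if (∀ j : Fin (m + 1), reply r j = pcs.commit pp (q.1 j)) ∧
            decodeVec F (2 * m + 1) (reply r (m + 1)).hd = some q.2 then
          evalAccept pcs P X sec pp r q.2 else 0) else 0

/-- Acceptance after the conversation `r`: either the prover behaves as in the ideal protocol, or
the last commitment has two openings, or the evaluation protocol accepts false values. -/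
theorem foldVerdict_true_le [Fintype (BPoly F (2 ^ m) d D)] {H : Finset F} {p : ℝ}
    (hp : US.HasSoundnessError H d p) (X : Fin (2 ^ m) → F) (z : Fin m → F) (sec : ℕ) (pp : Dat)
    (Γ : Dat → BPoly F (2 ^ m) d D) (hΓ : ∀ C, pcs.IsCommitment pp C → C = pcs.commit pp (Γ C))
    (r : Dat × List Dat) : foldVerdict pcs US P f S X z sec pp r true ≤
      foldPayoff H f S (ENNReal.ofReal p) X z (fun j => polysOf Γ r.2 j) +
      foldBad pcs P X sec pp r := by
  classical
  unfold foldVerdict foldBad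
  have hfalse : (PMF.pure false : PMF Bool) true = 0 := by simp
  rcases hy : decodeVec F (2 * m + 1) (reply r (m + 1)).hd with _ | y
  · simp [hfalse]
  rcases hg : decodePoly F (2 ^ m) d D (reply r (m + 1)).tl with _ | g
  · simp [hfalse]
  dsimp only
  rw [apply_true_eq_expec, expec_bind]
  simp only [expec_map, decide_eq_true_eq]
  by_cases hC : (∀ j < m, pcs.IsCommitment pp (reply r j)) ∧ pcs.opens pp g (reply r m) = true
  swap
  · refine (expec_le fun e => expec_le fun u => ?_).trans zero_le
    rw [if_neg fun h => hC ⟨h.1, h.2.1⟩]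
  have hopen := (pcs.opens_iff pp g _).1 hC.2
  have hcom : ∀ j : Fin (m + 1), reply r j = pcs.commit pp (Γ (reply r j)) := by
    intro j
    refine hΓ _ ?_
    rcases Nat.lt_succ_iff_lt_or_eq.1 j.2 with h | h
    · exact hC.1 _ h
    · rw [h]
      exact ⟨g, hopen⟩
  -- If `g` is not the chosen preimage, the two are different openings of the last commitment, and
  -- one term of the first sum equals 1.
  by_cases hgΓ : g = Γ (reply r m)
  swap
  · refine (expec_le (c := 1) fun e => expec_le fun u => by split_ifs <;> simp).trans ?_
    refine le_trans ?_ (le_trans le_self_add le_add_self)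
    refine le_trans (le_of_eq ?_) (Finset.single_le_sum (fun _ _ => zero_le)
      (Finset.mem_univ (g, Γ (reply r m))))
    rw [if_pos hgΓ, if_pos ⟨hopen, hcom (Fin.last m)⟩]
  -- True values lead to the ideal payoff; false ones make the evaluation protocol err, which is a
  -- term of the second sum.
  by_cases hv : y = foldValues X fun j : Fin (m + 1) => polysOf Γ r.2 j
  · refine le_trans ?_ le_self_add
    have hgm : g = polysOf Γ r.2 m := hgΓ
    unfold foldPayoff
    simp only [← hv, Fin.val_last, ← hgm]
    split_ifs with h1 h2
    · exact expec_le fun e => expec_le fun u => by split_ifs <;> simp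
    -- The sumcheck starts from whatever state the evaluation protocol has left, which its soundness
    -- against all strategies and states covers.
    · refine expec_le fun e => ?_
      refine le_trans ?_ (apply_true_le_ofReal (hp (toUnivariate g) (foldSum m z S y)
        (natDegree_toUnivariate_le (Nat.two_pow_pos m) g) h2 (P.run sec) e.2))
      rw [apply_true_eq_expec, expec_map]
      refine expec_mono fun u => ?_
      split_ifs with h3 h4
      · exact le_rfl
      · exact absurd h3.2.2.2.2 h4
      · exact zero_le
      · exact le_rfl
    · refine expec_le fun e => expec_le fun u => ?_
      rw [if_neg fun h => h1 h.2.2.1]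
  · refine le_trans ?_ (le_trans le_add_self le_add_self)
    refine le_trans ?_ (Finset.single_le_sum (fun _ _ => zero_le)
      (Finset.mem_univ ((fun j : Fin (m + 1) => polysOf Γ r.2 j), y)))
    rw [if_pos hv, if_pos ⟨hcom, rfl⟩, evalAccept, apply_true_eq_expec, expec_map]
    refine expec_mono fun e => expec_le fun u => ?_
    split_ifs with h3 h4
    · exact le_rfl
    · exact absurd h3.2.2.2.1 h4
    · exact zero_le
    · exact le_rfl

open Classical in
/-- The probability, for fixed coins of the verifier, that a commitment is opened in two ways or
that false values are accepted. -/
noncomputable def foldError [Fintype (BPoly F (2 ^ m) d D)] (X : Fin (2 ^ m) → F) (z : Fin m → F)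
    (sec : ℕ) : ℝ :=
  (∑ q : BPoly F (2 ^ m) d D × BPoly F (2 ^ m) d D, if q.1 ≠ q.2 then
      (bindingFailure pcs P f S X z q.1 q.2 sec).toReal else 0) +
    ∑ q : (Fin (m + 1) → BPoly F (2 ^ m) d D) × (Fin (2 * m + 1) → F),
      if q.2 ≠ foldValues X q.1 then
        (expec (pcs.setup sec) (convinceProb pcs P f S X z q.1 q.2 sec)).toReal else 0

theorem bindingFailure_le_one (X : Fin (2 ^ m) → F) (z : Fin m → F) (g₁ g₂ : BPoly F (2 ^ m) d D)
    (sec : ℕ) :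
    bindingFailure pcs P f S X z g₁ g₂ sec ≤ 1 :=
  expec_le fun pp => expec_le fun r => by split_ifs <;> simp

theorem convinceProb_le_one (X : Fin (2 ^ m) → F) (z : Fin m → F)
    (G : Fin (m + 1) → BPoly F (2 ^ m) d D) (y : Fin (2 * m + 1) → F) (sec : ℕ) (pp : Dat) : convinceProb pcs P f S X z G y sec pp ≤ 1 := by
  refine expec_le fun r => ?_
  split_ifs
  · exact PMF.coe_le_one _ _
  · simp

variable [Fintype (BPoly F (2 ^ m) d D)] (X : Fin (2 ^ m) → F) (z : Fin m → F)

theorem foldError_nonneg (sec : ℕ) : 0 ≤ foldError pcs P f S X z sec := by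
  refine add_nonneg (Finset.sum_nonneg fun q _ => ?_) (Finset.sum_nonneg fun q _ => ?_) <;>
    split_ifs <;> simp

theorem negligible_foldError (hbind : pcs.Binding)
    (heval : pcs.BatchEvalBinding (foldPlacement m)) :
    Negligible (foldError pcs P f S X z) := by
  refine (Negligible.sum _ fun q _ => ?_).add (Negligible.sum _ fun q _ => ?_)
  · by_cases h : q.1 = q.2
    · simpa [h] using Negligible.zero
    · simpa [h] using negligible_bindingFailure pcs P f S X z hbind h
  · by_cases h : q.2 = foldValues X q.1
    · simpa [h] using Negligible.zero
    · simpa [h] using negligible_convinceProb pcs P f S X z heval h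

open Classical in
theorem ofReal_foldError (sec : ℕ) : ENNReal.ofReal (foldError pcs P f S X z sec) =
    (∑ q : BPoly F (2 ^ m) d D × BPoly F (2 ^ m) d D, if q.1 ≠ q.2 then
        bindingFailure pcs P f S X z q.1 q.2 sec else 0) +
      ∑ q : (Fin (m + 1) → BPoly F (2 ^ m) d D) × (Fin (2 * m + 1) → F),
        if q.2 ≠ foldValues X q.1 then
          expec (pcs.setup sec) (convinceProb pcs P f S X z q.1 q.2 sec) else 0 := by
  have h1 : ∀ q : BPoly F (2 ^ m) d D × BPoly F (2 ^ m) d D, 0 ≤ if q.1 ≠ q.2 then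
      (bindingFailure pcs P f S X z q.1 q.2 sec).toReal else 0 := fun q => by
    split_ifs <;> simp
  have h2 : ∀ q : (Fin (m + 1) → BPoly F (2 ^ m) d D) × (Fin (2 * m + 1) → F), 0 ≤
      if q.2 ≠ foldValues X q.1 then
        (expec (pcs.setup sec) (convinceProb pcs P f S X z q.1 q.2 sec)).toReal else 0 := fun q => by
    split_ifs <;> simp
  rw [foldError, ENNReal.ofReal_add (Finset.sum_nonneg fun q _ => h1 q)
    (Finset.sum_nonneg fun q _ => h2 q), ENNReal.ofReal_sum_of_nonneg fun q _ => h1 q,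
    ENNReal.ofReal_sum_of_nonneg fun q _ => h2 q]
  congr 1
  · refine Finset.sum_congr rfl fun q _ => ?_
    split_ifs
    · exact ENNReal.ofReal_toReal ((bindingFailure_le_one pcs P f S X z _ _ sec).trans_lt
        ENNReal.one_lt_top).ne
    · simp
  · refine Finset.sum_congr rfl fun q _ => ?_
    split_ifs
    · exact ENNReal.ofReal_toReal ((expec_le fun pp =>
        convinceProb_le_one pcs P f S X z _ _ sec pp).trans_lt ENNReal.one_lt_top).ne
    · simp

theorem expec_foldBad (sec : ℕ) :
    (expec (pcs.setup sec) fun pp => expec (foldTalk P sec f S X z pp)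
      (foldBad pcs P X sec pp)) = ENNReal.ofReal (foldError pcs P f S X z sec) := by
  classical
  rw [ofReal_foldError]
  unfold foldBad
  simp only [expec_add, expec_finset_sum]
  congr 1
  · refine Finset.sum_congr rfl fun q _ => ?_
    split_ifs
    · rfl
    · simp only [expec_const]
  · refine Finset.sum_congr rfl fun q _ => ?_
    split_ifs
    · rfl
    · simp only [expec_const]

/-- The soundness of Fold-DCS up to the bad events, with the bound given by any sequence that
satisfies the recursion of the rounds. -/
theorem foldDCS_true_le {H : Finset F} {p : ℝ} (hD : 1 ≤ D) (hp : US.HasSoundnessError H d p)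
    (hp1 : ENNReal.ofReal p ≤ 1) {b : ℕ → ℝ≥0∞}
    (hb : max (ENNReal.ofReal p) ((D : ℝ≥0∞) / Fintype.card F) ≤ b 0)
    (hb' : ∀ n, (D : ℝ≥0∞) / Fintype.card F * (1 - b n) + b n ≤ b (n + 1))
    (hS : ∑ a ∈ Fintype.piFinset (fun _ : Fin (2 ^ m) => H), MvPolynomial.eval a f.1 ≠ S)
    (sec : ℕ) : foldDCS pcs US P sec f S true ≤ b m +
      ∑ X : Fin (2 ^ m) → F, ∑ z : Fin m → F, ENNReal.ofReal (foldError pcs P f S X z sec) := by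
  classical
  rw [foldDCS_eq, apply_true_eq_expec]
  simp only [expec_bind, ← apply_true_eq_expec]
  -- The choice of preimages need not be computable: it serves only the analysis of unbounded
  -- provers.
  have hΓ : ∀ pp, ∃ Γ : Dat → BPoly F (2 ^ m) d D,
      ∀ C, pcs.IsCommitment pp C → C = pcs.commit pp (Γ C) := fun pp =>
    ⟨fun C => if h : pcs.IsCommitment pp C then h.choose else f, fun C h => by
      dsimp only
      rw [dif_pos h]
      exact h.choose_spec⟩
  choose Γ hΓ using hΓ
  refine le_trans (expec_mono fun pp => expec_mono fun X => expec_mono fun z => expec_mono fun r =>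
    foldVerdict_true_le pcs US P f S hp X z sec pp (Γ pp) (hΓ pp) r) ?_
  simp only [expec_add]
  refine add_le_add (expec_le fun pp => ?_) ?_
  -- With the cut at 0 nothing is fixed yet, so the point `0` and the scalars `0` are dummies.
  · have h := expec_talk_foldPayoff_le H f S (ENNReal.ofReal p) hD hp1 hb hb' (Γ pp) (P.run sec) m 0
      (zero_add m) (startState (Dat.cons pp (Dat.cons (codePoly f) (code S)))) [] 0 0 rfl ?_
    · simp only [foldStart_zero, splice_zero] at h
      exact h
    · simp only [FoldTrue, tailSum, foldStart_zero, splice_zero, foldClaim, foldPoly,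
        Finset.range_zero, Finset.sum_empty, add_zero]
      have hc : cube H (2 ^ m) 0 (2 ^ m) = Fintype.piFinset fun _ => H := by
        simp [cube]
      rwa [hc]
  -- The coins are moved in front of the parameters, so that each of their values yields one game
  -- with built-in coins.
  · rw [expec_comm]
    refine (expec_uniform_le_sum _).trans (Finset.sum_le_sum fun X _ => ?_)
    rw [expec_comm]
    refine (expec_uniform_le_sum _).trans (Finset.sum_le_sum fun z _ => ?_)
    exact (expec_foldBad pcs P f S X z sec).le

end

/-! ### The bound -/

section

variable {m D q : ℕ} {p : ℝ}

/-- The right side is 1 - (1 - D/q)(1 - 1/q). The analysis needs only D/q per round, so the stated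
bound holds with σ = 0. -/
theorem div_le_roundError (hq : 0 < q) (hDq : D ≤ q) :
    (D : ℝ) / q ≤ ((D : ℝ) + 1) / q - D / (q : ℝ) ^ 2 := by
  have hq' : (0 : ℝ) < q := by exact_mod_cast hq
  have h : (D : ℝ) ≤ q := by exact_mod_cast hDq
  have e : ((D : ℝ) + 1) / q - D / (q : ℝ) ^ 2 - D / q = (q - D) / (q : ℝ) ^ 2 := by
    field_simp
    ring
  have : 0 ≤ ((q : ℝ) - D) / (q : ℝ) ^ 2 := div_nonneg (by linarith) (by positivity)
  linarith

theorem roundError_le_one (hq : 0 < q) (hDq : D ≤ q) :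
    ((D : ℝ) + 1) / q - D / (q : ℝ) ^ 2 ≤ 1 := by
  have hq' : (1 : ℝ) ≤ q := by exact_mod_cast hq
  have h : (D : ℝ) ≤ q := by exact_mod_cast hDq
  have e : 1 - (((D : ℝ) + 1) / q - D / (q : ℝ) ^ 2) = (q - D) * (q - 1) / (q : ℝ) ^ 2 := by
    field_simp
    ring
  have : 0 ≤ ((q : ℝ) - D) * (q - 1) / (q : ℝ) ^ 2 :=
    div_nonneg (mul_nonneg (by linarith) (by linarith)) (by positivity)
  linarith

/-- Bernoulli's inequality bounds the loss by m times the round error plus D/q, and each of these m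
+ 1 quantities is at most (D+1)/q. -/
theorem soundnessBound_le (hq : 0 < q) (hDq : D ≤ q) (hp : p ≤ (D : ℝ) / q) (ε : ℝ) :
    soundnessBound m D q p ε 0 ≤ (m + 1) * (ε + ((D : ℝ) + 1) / q * (1 + 0)) := by
  have hq' : (0 : ℝ) < q := by exact_mod_cast hq
  have h1 := div_le_roundError hq hDq
  have h2 := roundError_le_one hq hDq
  have h3 : (0 : ℝ) ≤ (D : ℝ) / q := by positivity
  have h4 : (D : ℝ) / q ≤ 1 := h1.trans h2
  have h5 : (0 : ℝ) ≤ D / (q : ℝ) ^ 2 := by positivity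
  have h6 : (D : ℝ) / q ≤ ((D : ℝ) + 1) / q := by gcongr; linarith
  rw [soundnessBound, max_eq_right hp]
  set δ := ((D : ℝ) + 1) / q - D / (q : ℝ) ^ 2 with hδ
  have hb : 1 - m * δ ≤ (1 - δ) ^ m := by
    have := one_add_mul_le_pow (a := -δ) (by linarith) m
    calc 1 - m * δ = 1 + m * -δ := by ring
      _ ≤ (1 + -δ) ^ m := this
      _ = (1 - δ) ^ m := by rw [← sub_eq_add_neg]
  have hm : (0 : ℝ) ≤ m := Nat.cast_nonneg m
  have h7 : (1 - m * δ) * (1 - (D : ℝ) / q + 0) ≤ (1 - δ) ^ m * (1 - (D : ℝ) / q + 0) :=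
    mul_le_mul_of_nonneg_right hb (by linarith)
  have h8 : 0 ≤ m * δ * ((D : ℝ) / q) := mul_nonneg (mul_nonneg hm (h3.trans h1)) h3
  have h9 : m * δ ≤ m * (((D : ℝ) + 1) / q) := mul_le_mul_of_nonneg_left (by linarith) hm
  nlinarith

end

theorem prob_le_one (q : PMF Bool) : prob q ≤ 1 :=
  ENNReal.toReal_le_of_le_ofReal zero_le_one (by simpa using PMF.coe_le_one q true)

/-- The soundness bound as a function of the number of rounds satisfies the recursion of the rounds. -/
theorem ofReal_soundness_step {D q : ℕ} {M : ℝ} (hq : 0 < q) (hDq : D ≤ q) (hM0 : 0 ≤ M)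
    (hM1 : M ≤ 1) (n : ℕ) {b : ℕ → ℝ≥0∞}
    (hb : ∀ n, b n = ENNReal.ofReal
      (1 - (1 - (((D : ℝ) + 1) / q - D / (q : ℝ) ^ 2)) ^ n * (1 - M))) :
    (D : ℝ≥0∞) / q * (1 - b n) + b n ≤ b (n + 1) := by
  have h1 := div_le_roundError hq hDq
  have h2 := roundError_le_one hq hDq
  have hq' : (0 : ℝ) < q := by exact_mod_cast hq
  have h3 : (0 : ℝ) ≤ (D : ℝ) / q := by positivity
  rw [hb, hb]
  set δ := ((D : ℝ) + 1) / q - D / (q : ℝ) ^ 2 with hδ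
  set t := (1 - δ) ^ n * (1 - M) with ht
  have ht0 : 0 ≤ t := mul_nonneg (pow_nonneg (by linarith) n) (by linarith)
  have ht1 : t ≤ 1 := mul_le_one₀ (pow_le_one₀ (by linarith) (by linarith)) (by linarith)
    (by linarith)
  have e : (D : ℝ≥0∞) / q = ENNReal.ofReal ((D : ℝ) / q) := by
    rw [ENNReal.ofReal_div_of_pos hq', ENNReal.ofReal_natCast, ENNReal.ofReal_natCast]
  rw [e, ← ENNReal.ofReal_one, ← ENNReal.ofReal_sub _ (by linarith), sub_sub_cancel,
    ← ENNReal.ofReal_mul h3, ← ENNReal.ofReal_add (by positivity) (by linarith)]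
  refine ENNReal.ofReal_le_ofReal ?_
  have h4 : (1 - δ) ^ (n + 1) * (1 - M) = (1 - δ) * t := by rw [ht, pow_succ]; ring
  rw [h4]
  have := mul_le_mul_of_nonneg_right h1 ht0
  linarith

/-- Computational soundness of Fold-DCS. The field and the degrees are fixed, so that there are only
finitely many polynomials and coins of the verifier; the adversaries against the commitment scheme
have them built in, and no extractor has to be run. -/
theorem mainTheorem3 {F : Type*} [Field F] [Fintype F] (H : Finset F)
    (m d D : ℕ) (hm : 1 ≤ m) (hd : 1 ≤ d) (hD : 1 ≤ D) (hDF : D ≤ Fintype.card F)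
    (pcs : PCS F (2 ^ m) d D) (hext : pcs.Extractable) (hbind : pcs.Binding)
    (heval : pcs.BatchEvalBinding (foldPlacement m))
    (US : USVerifier F) (p : ℝ) (hp : US.HasSoundnessError H d p) (P : PPT) :
    ∃ ε σ : ℕ → ℝ, Negligible ε ∧ Negligible σ ∧ (∀ sec, 0 ≤ ε sec) ∧ (∀ sec, 0 ≤ σ sec) ∧
      (∀ (sec : ℕ) (f : BPoly F (2 ^ m) d D) (S : F),
        ∑ a ∈ Fintype.piFinset (fun _ : Fin (2 ^ m) => H), MvPolynomial.eval a f.1 ≠ S →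
        prob (foldDCS pcs US P sec f S) ≤
          soundnessBound m D (Fintype.card F) p (ε sec) (σ sec)) ∧
      (p ≤ (D : ℝ) / Fintype.card F → ∀ sec,
        soundnessBound m D (Fintype.card F) p (ε sec) (σ sec) ≤
          (m + 1) * (ε sec + ((D : ℝ) + 1) / Fintype.card F * (1 + σ sec))) := by
  classical
  let _ : Fintype (BPoly F (2 ^ m) d D) := Fintype.ofFinite _
  have hq : 0 < Fintype.card F := Fintype.card_pos
  -- Summing over `f` and `S` as well makes the error independent of the instance.
  set ε : ℕ → ℝ := fun sec => ∑ f : BPoly F (2 ^ m) d D, ∑ S : F, ∑ X : Fin (2 ^ m) → F,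
    ∑ z : Fin m → F, foldError pcs P f S X z sec with hε
  have hnn : ∀ sec (f : BPoly F (2 ^ m) d D) (S : F), 0 ≤ ∑ X : Fin (2 ^ m) → F,
      ∑ z : Fin m → F, foldError pcs P f S X z sec := fun sec f S =>
    Finset.sum_nonneg fun X _ => Finset.sum_nonneg fun z _ => foldError_nonneg pcs P f S X z sec
  have hε0 : ∀ sec, 0 ≤ ε sec := fun sec =>
    Finset.sum_nonneg fun f _ => Finset.sum_nonneg fun S _ => hnn sec f S
  refine ⟨ε, fun _ => 0, ?_, Negligible.zero, hε0, fun _ => le_rfl, fun sec f S hS => ?_,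
    fun hpD sec => soundnessBound_le hq hDF hpD (ε sec)⟩
  · exact Negligible.sum _ fun f _ => Negligible.sum _ fun S _ => Negligible.sum _ fun X _ =>
      Negligible.sum _ fun z _ => negligible_foldError pcs P f S X z hbind heval
  set M := max p ((D : ℝ) / Fintype.card F) with hM
  set δ := ((D : ℝ) + 1) / Fintype.card F - D / (Fintype.card F : ℝ) ^ 2 with hδ
  have hq' : (0 : ℝ) < Fintype.card F := by exact_mod_cast hq
  have hM0 : 0 ≤ M := le_max_of_le_right (by positivity)
  have hδ0 : 0 ≤ δ := le_trans (by positivity) (div_le_roundError hq hDF)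
  have hδ1 : δ ≤ 1 := roundError_le_one hq hDF
  have hpow : 0 ≤ (1 - δ) ^ m := pow_nonneg (by linarith) m
  have hmε : ε sec ≤ (m + 1) * ε sec := le_mul_of_one_le_left (hε0 sec) (by simp)
  rw [soundnessBound, ← hM, ← hδ, add_zero]
  -- For `M > 1` the stated bound is at least 1 and nothing is to be proved; `M ≤ 1` is what the
  -- recursion needs.
  rcases le_or_gt M 1 with hM1 | hM1
  swap
  · have h1 := prob_le_one (foldDCS pcs US P sec f S)
    have h2 : (1 - δ) ^ m * (1 - M) ≤ 0 := mul_nonpos_of_nonneg_of_nonpos hpow (by linarith)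
    linarith [hε0 sec]
  have hp1 : ENNReal.ofReal p ≤ 1 := ENNReal.ofReal_le_one.2 ((le_max_left _ _).trans hM1)
  have h := foldDCS_true_le pcs US P f S hD hp hp1
    (b := fun n => ENNReal.ofReal (1 - (1 - δ) ^ n * (1 - M))) ?_
    (fun n => ofReal_soundness_step hq hDF hM0 hM1 n fun _ => rfl) hS sec
  · have ht1 : (1 - δ) ^ m * (1 - M) ≤ 1 :=
      mul_le_one₀ (pow_le_one₀ (by linarith) (by linarith)) (by linarith) (by linarith)
    have e : ∑ X : Fin (2 ^ m) → F, ∑ z : Fin m → F,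
        ENNReal.ofReal (foldError pcs P f S X z sec) =
        ENNReal.ofReal (∑ X : Fin (2 ^ m) → F, ∑ z : Fin m → F, foldError pcs P f S X z sec) := by
      rw [ENNReal.ofReal_sum_of_nonneg fun X _ => Finset.sum_nonneg fun z _ =>
        foldError_nonneg pcs P f S X z sec]
      refine Finset.sum_congr rfl fun X _ => ?_
      rw [ENNReal.ofReal_sum_of_nonneg fun z _ => foldError_nonneg pcs P f S X z sec]
    rw [e, ← ENNReal.ofReal_add (by linarith) (hnn sec f S)] at h
    have h1 := ENNReal.toReal_le_of_le_ofReal (add_nonneg (by linarith) (hnn sec f S)) h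
    have h2 : ∑ X : Fin (2 ^ m) → F, ∑ z : Fin m → F, foldError pcs P f S X z sec ≤ ε sec :=
      (Finset.single_le_sum (fun S _ => hnn sec f S) (Finset.mem_univ S)).trans
        (Finset.single_le_sum (f := fun f => ∑ S : F, ∑ X : Fin (2 ^ m) → F, ∑ z : Fin m → F,
          foldError pcs P f S X z sec) (fun f _ => Finset.sum_nonneg fun S _ => hnn sec f S)
          (Finset.mem_univ f))
    rw [prob]
    linarith
  · simp only [pow_zero, one_mul, sub_sub_cancel]
    rw [hM, ENNReal.ofReal_max, ENNReal.ofReal_div_of_pos hq', ENNReal.ofReal_natCast,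
      ENNReal.ofReal_natCast]
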